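/- Let $q\in\mathbb{C}\setminus\{0\}$ be not a root of unity and let $A$ be the standard Podle\'s quantum 2-sphere, i.e. the universal unital $\mathbb{C}$-algebra with generators $x_{-1},x_0,x_1$ and relations $$x_{\pm1}x_0=q^{\mp2}x_0x_{\pm1},\qquad x_{\pm1}x_{\mp1}=q^{\mp2}x_0^2+q^{\mp1}x_0 .$$ For $\sigma\in\mathrm{Aut}(A)$ (automorphisms of $\mathbb{C}$-algebras) let ${}_\sigma A$ be the bimodule $A$ with actions $a\triangleright b\triangleleft c=\sigma(a)bc$, and let $H_n(A,{}_\sigma A)$ be the homology of the complex $A^{\otimes(n+1)}$ with boundary $$b(a_0\otimes\cdots\otimes a_n)=\sum_{i=0}^{n-1}(-1)^i a_0\otimes\cdots\otimes a_ia_{i+1}\otimes\cdots\otimes a_n+(-1)^n\sigma(a_n)a_0\otimes a_1\otimes\cdots\otimes a_{n-1}.$$ Let $H^0(A,{}_\sigma A)=\{a\in A: ab=\sigma(b)a\ \text{for all } b\in A\}$ be the space of $\sigma$-central elements, i.e. the degree $0$ Hochschild cohomology with coefficients in ${}_\sigma A$. The twisted centre of $A$ is $\Lambda^0(A)=\bigoplus_{\sigma\in\mathrm{Aut}(A)}H^0(A,{}_\sigma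 A)$ with the cup product $H^0(A,{}_\sigma A)\otimes H^0(A,{}_\tau A)\to H^0(A,{}_{\tau\circ\sigma}A)$, $a\smallsmile b=\tau(a)b=ba$. It acts from the right on $\bigoplus_\sigma H_2(A,{}_\sigma A)$ by the cap product $H_2(A,{}_\sigma A)\otimes H^0(A,{}_\tau A)\to H_2(A,{}_{\tau\circ\sigma}A)$, $[a_0\otimes a_1\otimes a_2]\smallfrown c=[\tau(a_0)c\otimes a_1\otimes a_2]$. Let $\sigma_{\mathrm{mod}}$ be the automorphism with $\sigma_{\mathrm{mod}}(x_n)=q^{2n}x_n$, and let $[\mathrm{d}A]\in H_2(A,{}_{\sigma_{\mathrm{mod}}}A)$ be the fundamental class, i.e. the class of the cycle \begin{align*}\mathrm{d}A={}&2x_1\otimes(x_{-1}\otimes x_0-q^2x_0\otimes x_{-1})+2x_{-1}\otimes(q^{-2}x_0\otimes x_1-x_1\otimes x_0)\\&+1\otimes(qx_1\otimes x_{-1}-q^{-1}x_{-1}\otimes x_1+(q-q^{-1})x_0\otimes x_0)\\&+2x_0\otimes(x_1\otimes x_{-1}-x_{-1}\otimes x_1+(q^2-q^{-2})x_0\otimes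 x_0).\end{align*} Then: 1. $x_0$ is $\sigma_{\mathrm{mod}}$-central, and the twisted centre $\Lambda^0(A)$ is the polynomial algebra $\mathbb{C}[x_0]$ in $x_0\in H^0(A,{}_{\sigma_{\mathrm{mod}}}A)$: the element $x_0$ generates $\Lambda^0(A)$ as an algebra, and the evaluation map $\mathbb{C}[X]\to\Lambda^0(A)$, $X\mapsto x_0$, is injective. 2. For every automorphism $\sigma$ of $A$ and every $[\omega]\in H_2(A,{}_\sigma A)$ there is exactly one polynomial $f\in\mathbb{C}[x_0]$ such that $[\omega]=[\mathrm{d}A]\smallfrown f$ in $\bigoplus_\tau H_2(A,{}_\tau A)$. 3. Consequently $\bigoplus_\sigma H_2(A,{}_\sigma A)$ is a free $\mathbb{C}[x_0]$-module of rank $1$ with basis $[\mathrm{d}A]$. -/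

import Mathlib

open scoped TensorProduct DirectSum Polynomial

noncomputable section
namespace TwistedHochschild

theorem update_pair_zero {A : Type*} (a b y : A) : Function.update ![a, b] 0 y = ![y, b] := by
  funext i; fin_cases i <;> rfl

theorem update_pair_one {A : Type*} (a b y : A) : Function.update ![a, b] 1 y = ![a, y] := by
  funext i; fin_cases i <;> rfl

section General
variable {k A : Type*} [CommRing k] [Ring A] [Algebra k A]

theorem contractNth_update {n : ℕ} (i : Fin n) [D : DecidableEq (Fin (n + 1))] (a : Fin (n + 1) → A)
    (m : Fin (n + 1)) (z : A) :
    Fin.contractNth i.castSucc (· * ·) (Function.update a m z) =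
      Function.update (Fin.contractNth i.castSucc (· * ·) a) (i.predAbove m)
        (if m = i.castSucc then z * a i.succ else if m = i.succ then a i.castSucc * z else z) := by
  rw [Subsingleton.elim D (instDecidableEqFin _)]
  funext j
  simp only [Fin.contractNth, Function.update_apply, Fin.predAbove, Fin.ext_iff, Fin.lt_def]
  split_ifs <;> simp_all <;>
    first | omega | (congr 2 <;> simp_all [Fin.ext_iff] <;> omega)

/-- The face map `a₀ ⊗ ⋯ ⊗ aₙ ↦ a₀ ⊗ ⋯ ⊗ aᵢaᵢ₊₁ ⊗ ⋯ ⊗ aₙ`. -/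
def face (k : Type*) {A : Type*} [CommRing k] [Ring A] [Algebra k A] {n : ℕ} (i : Fin n) :
    MultilinearMap k (fun _ : Fin (n + 1) => A) (⨂[k] _ : Fin n, A) where
  toFun a := PiTensorProduct.tprod k (Fin.contractNth i.castSucc (· * ·) a)
  map_update_add' a m x y := by
    simp only [contractNth_update]
    rw [← MultilinearMap.map_update_add]
    congr 2
    split_ifs <;> simp [add_mul, mul_add]
  map_update_smul' a m c x := by
    simp only [contractNth_update]
    rw [← MultilinearMap.map_update_smul]
    congr 2
    split_ifs <;> simp

theorem cyclic_update {n : ℕ} (σ : A ≃ₐ[k] A) [D : DecidableEq (Fin (n + 2))] (a : Fin (n + 2) → A)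
    (m : Fin (n + 2)) (z : A) :
    (Fin.cons (σ (Function.update a m z (Fin.last (n + 1))) * Function.update a m z 0)
      (fun j : Fin n => Function.update a m z j.succ.castSucc) : Fin (n + 1) → A) =
    Function.update (Fin.cons (σ (a (Fin.last (n + 1))) * a 0)
      (fun j : Fin n => a j.succ.castSucc) : Fin (n + 1) → A)
      (if h : m = Fin.last (n + 1) then 0 else m.castPred h)
      (if m = Fin.last (n + 1) then σ z * a 0 else if m = 0 then σ (a (Fin.last (n + 1))) * z else z)
       := by
  rw [Subsingleton.elim D (instDecidableEqFin _)]
  funext j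
  induction m using Fin.lastCases with
  | last =>
    refine Fin.cases ?_ (fun j => ?_) j
    · simp [Function.update_apply, Fin.ext_iff]
    · simp
  | cast m =>
    have h1 : (m.castSucc : Fin (n + 2)) ≠ Fin.last (n + 1) := Fin.castSucc_ne_last _
    rw [dif_neg h1, if_neg h1, Fin.castPred_castSucc]
    refine Fin.cases ?_ (fun j => ?_) j
    · revert h1
      refine Fin.cases (fun _ => ?_) (fun m h1 => ?_) m
      · simp [Fin.ext_iff]
      · simp only [Fin.cons_zero, Function.update_apply, if_neg h1.symm]
        simp [Fin.ext_iff]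
    · revert h1
      refine Fin.cases (fun _ => ?_) (fun m h1 => ?_) m
      · simp [Fin.ext_iff]
      · simp [Function.update_apply, Fin.ext_iff]

/-- The cyclic face map `a₀ ⊗ ⋯ ⊗ aₙ₊₁ ↦ σ(aₙ₊₁)a₀ ⊗ a₁ ⊗ ⋯ ⊗ aₙ`. -/
def cyclicFace (σ : A ≃ₐ[k] A) (n : ℕ) :
    MultilinearMap k (fun _ : Fin (n + 2) => A) (⨂[k] _ : Fin (n + 1), A) where
  toFun a := PiTensorProduct.tprod k
    (Fin.cons (σ (a (Fin.last (n + 1))) * a 0) (fun j : Fin n => a j.succ.castSucc))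
  map_update_add' a m x y := by
    simp only [cyclic_update]
    rw [← MultilinearMap.map_update_add]
    congr 2
    split_ifs <;> simp [add_mul, mul_add]
  map_update_smul' a m c x := by
    simp only [cyclic_update]
    rw [← MultilinearMap.map_update_smul]
    congr 2
    split_ifs <;> simp

/-- The space `C_n = A^{⊗(n+1)}` of Hochschild chains. -/
abbrev Chain (k A : Type*) [CommRing k] [Ring A] [Algebra k A] (n : ℕ) : Type _ :=
  ⨂[k] _ : Fin (n + 1), A

/-- The twisted Hochschild boundary `b : C_{n+1} → C_n`,
`b(a₀ ⊗ ⋯ ⊗ aₙ₊₁) = ∑ᵢ₌₀ⁿ (-1)ⁱ a₀ ⊗ ⋯ ⊗ aᵢaᵢ₊₁ ⊗ ⋯ ⊗ aₙ₊₁ + (-1)ⁿ⁺¹ σ(aₙ₊₁)a₀ ⊗ a₁ ⊗ ⋯ ⊗ aₙ`. -/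
def boundary (σ : A ≃ₐ[k] A) (n : ℕ) : Chain k A (n + 1) →ₗ[k] Chain k A n :=
  PiTensorProduct.lift
    (∑ i : Fin (n + 1), (-1 : k) ^ (i : ℕ) • face k i + (-1 : k) ^ (n + 1) • cyclicFace σ n)

theorem boundary_tprod (σ : A ≃ₐ[k] A) (n : ℕ) (a : Fin (n + 2) → A) :
    boundary σ n (PiTensorProduct.tprod k a) =
      ∑ i : Fin (n + 1), (-1 : k) ^ (i : ℕ) •
        PiTensorProduct.tprod k (Fin.contractNth i.castSucc (· * ·) a) +
      (-1 : k) ^ (n + 1) • PiTensorProduct.tprod k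
        (Fin.cons (σ (a (Fin.last (n + 1))) * a 0) (fun j : Fin n => a j.succ.castSucc)) := by
  simp [boundary, face, cyclicFace, PiTensorProduct.lift.tprod]

/-- The cycles `Z_n(A, σA)`. -/
def cycles (σ : A ≃ₐ[k] A) : (n : ℕ) → Submodule k (Chain k A n)
  | 0 => ⊤
  | n + 1 => LinearMap.ker (boundary σ n)

/-- The boundaries `B_n(A, σA)`. -/
def boundaries (σ : A ≃ₐ[k] A) (n : ℕ) : Submodule k (Chain k A n) :=
  LinearMap.range (boundary σ n)

/-- The Hochschild homology `H_n(A, σA)` (cycles modulo boundaries). -/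
def Homology (σ : A ≃ₐ[k] A) (n : ℕ) : Type _ :=
  cycles σ n ⧸ (boundaries σ n).submoduleOf (cycles σ n)

instance (σ : A ≃ₐ[k] A) (n : ℕ) : AddCommGroup (Homology σ n) :=
  inferInstanceAs (AddCommGroup (cycles σ n ⧸ (boundaries σ n).submoduleOf (cycles σ n)))

instance (σ : A ≃ₐ[k] A) (n : ℕ) : Module k (Homology σ n) :=
  inferInstanceAs (Module k (cycles σ n ⧸ (boundaries σ n).submoduleOf (cycles σ n)))

/-- The homology class `[z]` of a cycle `z`. -/
def homologyClass (σ : A ≃ₐ[k] A) (n : ℕ) : cycles σ n →ₗ[k] Homology σ n :=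
  ((boundaries σ n).submoduleOf (cycles σ n)).mkQ

theorem homologyClass_surjective (σ : A ≃ₐ[k] A) (n : ℕ) :
    Function.Surjective (homologyClass σ n) :=
  Submodule.mkQ_surjective _

/-- The space `C^n = Hom_k(A^{⊗n}, A)` of Hochschild cochains, as multilinear maps. -/
abbrev Cochain (k A : Type*) [CommRing k] [Ring A] [Algebra k A] (n : ℕ) : Type _ :=
  MultilinearMap k (fun _ : Fin n => A) A

/-- The twisted Hochschild coboundary `C^n → C^{n+1}`, see `coboundary_apply`. -/
def coboundary (σ : A ≃ₐ[k] A) (n : ℕ) : Cochain k A n →ₗ[k] Cochain k A (n + 1) where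
  toFun ψ :=
    LinearMap.uncurryLeft (M := fun _ : Fin (n + 1) => A)
      { toFun := fun a₀ => (LinearMap.mulLeft k (σ a₀)).compMultilinearMap ψ
        map_add' := fun x y => by ext; simp [add_mul]
        map_smul' := fun c x => by ext; simp }
    + ∑ i : Fin n, (-1 : k) ^ ((i : ℕ) + 1) •
        (PiTensorProduct.lift ψ).compMultilinearMap (face k i)
    + (-1 : k) ^ (n + 1) •
        MultilinearMap.uncurryRight (M := fun _ : Fin (n + 1) => A)
          ((LinearMap.mul k A).compMultilinearMap ψ)
  map_add' φ ψ := by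
    ext a
    simp only [map_add, add_apply, sum_apply, smul_apply,
      LinearMap.uncurryLeft_apply, MultilinearMap.uncurryRight_apply, LinearMap.coe_mk,
      AddHom.coe_mk, LinearMap.compMultilinearMap_apply, LinearMap.add_apply, smul_add,
      Finset.sum_add_distrib]
    abel
  map_smul' c ψ := by
    ext a
    simp [Finset.smul_sum, smul_comm c]

theorem coboundary_apply (σ : A ≃ₐ[k] A) (n : ℕ) (ψ : Cochain k A n) (a : Fin (n + 1) → A) :
    coboundary σ n ψ a =
      σ (a 0) * ψ (Fin.tail a)
      + ∑ i : Fin n, (-1 : k) ^ ((i : ℕ) + 1) • ψ (Fin.contractNth i.castSucc (· * ·) a)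
      + (-1 : k) ^ (n + 1) • (ψ (Fin.init a) * a (Fin.last n)) := by
  simp [coboundary, face]

/-- `H^0(A, σA)`: the kernel of the coboundary `C^0 → C^1`, where a cochain `ψ ∈ C^0` is identified
with the element `ψ(1) ∈ A`. -/
def HZero (σ : A ≃ₐ[k] A) : Submodule k A :=
  (LinearMap.ker (coboundary σ 0)).comap
    (MultilinearMap.constLinearEquivOfIsEmpty (R := k) (S := k) (M₁ := fun _ : Fin 0 => A)
      (M₂ := A)).toLinearMap

/-- `H^0(A, σA)` consists of the `σ`-central elements of `A`. -/
theorem mem_HZero {σ : A ≃ₐ[k] A} {a : A} : a ∈ HZero σ ↔ ∀ b, a * b = σ b * a := by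
  simp only [HZero, Submodule.mem_comap, LinearMap.mem_ker, MultilinearMap.ext_iff,
    coboundary_apply]
  constructor
  · intro h b
    have := h (fun _ => b)
    simp at this
    exact (neg_add_eq_zero.1 (by rw [add_comm]; simpa [sub_eq_add_neg] using this))
  · intro h x
    simp [h]

/-- The cup product of cochains,
`(φ ⌣ ψ)(a₁, …, aₘ₊ₙ) = τ(φ(a₁, …, aₘ)) ψ(aₘ₊₁, …, aₘ₊ₙ)` for `ψ ∈ C^n_τ`, in degrees
`m = n = 0`; it maps `H^0(A, σA) × H^0(A, τA)` to `H^0(A, τσA)`. -/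
def cup {σ τ : A ≃ₐ[k] A} (a : HZero σ) (b : HZero τ) : HZero (τ * σ) :=
  ⟨τ a * b, mem_HZero.2 fun c => by
    have ha := mem_HZero.1 a.2
    have hb := mem_HZero.1 b.2
    rw [mul_assoc, hb, ← mul_assoc, ← map_mul, ha, map_mul, mul_assoc]; rfl⟩

/-- In degree 0 the cup product is the opposite product of `A`. -/
theorem coe_cup {σ τ : A ≃ₐ[k] A} (a : HZero σ) (b : HZero τ) : (cup a b : A) = b * a :=
  (mem_HZero.1 b.2 _).symm

variable (k A) in
/-- The grading monoid of the twisted centre, written additively. As `H^0(A, σA) ⌣ H^0(A, τA)` lies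
in `H^0(A, τσA)`, this is the opposite of the group `Aut(A)`. -/
abbrev Idx : Type _ := Additive (A ≃ₐ[k] A)ᵐᵒᵖ

/-- The graded piece `H^0(A, σA)`. -/
abbrev HZeroPiece (i : Idx k A) : Type _ := HZero (MulOpposite.unop i.toMul)

instance : GradedMonoid.GOne (HZeroPiece (k := k) (A := A)) where
  one := ⟨1, mem_HZero.2 fun b => by simp⟩

instance : GradedMonoid.GMul (HZeroPiece (k := k) (A := A)) where
  mul a b := cup a b

theorem coe_gone : ((GradedMonoid.GOne.one : HZeroPiece (k := k) (A := A) 0) : A) = 1 := rfl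

theorem coe_gmul {i j : Idx k A} (a : HZeroPiece i) (b : HZeroPiece j) :
    ((GradedMonoid.GMul.mul a b : HZeroPiece (i + j)) : A) = b * a := coe_cup a b

theorem gradedMonoid_ext {x y : GradedMonoid (HZeroPiece (k := k) (A := A))} (h : x.1 = y.1)
    (h' : (x.2 : A) = y.2) : x = y := Sigma.subtype_ext h h'

instance : DirectSum.GRing (HZeroPiece (k := k) (A := A)) where
  mul_zero a := Subtype.ext (by simp [coe_gmul])
  zero_mul a := Subtype.ext (by simp [coe_gmul])
  mul_add a b c := Subtype.ext (by simp [coe_gmul, add_mul])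
  add_mul a b c := Subtype.ext (by simp [coe_gmul, mul_add])
  one_mul a := gradedMonoid_ext (zero_add _) ((coe_gmul _ _).trans (mul_one _))
  mul_one a := gradedMonoid_ext (add_zero _) ((coe_gmul _ _).trans (one_mul _))
  mul_assoc a b c := gradedMonoid_ext (add_assoc _ _ _) (by
    refine (coe_gmul _ _).trans (.trans ?_ (coe_gmul _ _).symm)
    exact (congrArg _ (coe_gmul _ _)).trans
      ((mul_assoc _ _ _).symm.trans (congrArg (· * _) (coe_gmul _ _).symm)))
  natCast n := ⟨n, mem_HZero.2 fun b => by simpa using (Nat.cast_commute n b).eq⟩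
  natCast_zero := Subtype.ext (by simp)
  natCast_succ n := Subtype.ext (by simp [coe_gone])
  intCast n := ⟨n, mem_HZero.2 fun b => by simpa using (Int.cast_commute n b).eq⟩
  intCast_ofNat n := Subtype.ext (by simp)
  intCast_negSucc_ofNat n := Subtype.ext (by simp)

instance : DirectSum.GAlgebra k (HZeroPiece (k := k) (A := A)) where
  toFun :=
    { toFun := fun r => ⟨algebraMap k A r, mem_HZero.2 fun b => by
        simpa using Algebra.commutes r b⟩
      map_zero' := Subtype.ext (map_zero _)
      map_add' := fun r s => Subtype.ext (map_add _ r s) }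
  map_one := Subtype.ext (map_one (algebraMap k A))
  map_mul r s := gradedMonoid_ext (add_zero _).symm (by
    refine (map_mul (algebraMap k A) r s).trans (.trans ?_ (coe_gmul _ _).symm)
    exact Algebra.commutes r _)
  commutes r x := gradedMonoid_ext ((zero_add _).trans (add_zero _).symm) (by
    refine (coe_gmul _ x.2).trans (.trans ?_ (coe_gmul x.2 _).symm)
    exact (Algebra.commutes r (x.2 : A)).symm)
  smul_def r x := gradedMonoid_ext (zero_add _).symm (by
    refine (Algebra.smul_def r (x.2 : A)).trans
      ((Algebra.commutes r (x.2 : A)).trans (.trans ?_ (coe_gmul _ x.2).symm))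
    rfl)

variable (k A) in
/-- The twisted centre `Λ⁰(A) = ⨁_σ H^0(A, σA)`, the sum ranging over all `σ ∈ Aut(A)`. -/
def TwistedCentre : Type _ := ⨁ i : Idx k A, HZeroPiece i

open Classical in
/-- The twisted centre is an algebra under the cup product. -/
instance : Ring (TwistedCentre k A) := inferInstanceAs (Ring (⨁ i : Idx k A, HZeroPiece i))

open Classical in
instance : Algebra k (TwistedCentre k A) :=
  inferInstanceAs (Algebra k (⨁ i : Idx k A, HZeroPiece i))

open Classical in
/-- The inclusion of the summand `H^0(A, σA)`. -/
def TwistedCentre.of (σ : A ≃ₐ[k] A) : HZero σ →ₗ[k] TwistedCentre k A :=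
  DirectSum.lof k (Idx k A) HZeroPiece (Additive.ofMul (MulOpposite.op σ))

theorem TwistedCentre.of_mul_of {σ τ : A ≃ₐ[k] A} (a : HZero σ) (b : HZero τ) :
    of σ a * of τ b = of (τ * σ) (cup a b) := by
  classical
  exact DirectSum.of_mul_of (A := HZeroPiece (k := k) (A := A)) _ _

theorem TwistedCentre.one_def : (1 : TwistedCentre k A) = of 1 ⟨1, mem_HZero.2 fun b => by simp⟩ :=
  rfl

/-- The cap product of chains with `c ∈ H^0(A, τA)`,
`(a₀ ⊗ ⋯ ⊗ aₙ) ⌢ c = τ(a₀)c ⊗ a₁ ⊗ ⋯ ⊗ aₙ`. -/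
def capChain (τ : A ≃ₐ[k] A) (n : ℕ) (c : A) : Chain k A n →ₗ[k] Chain k A n :=
  PiTensorProduct.map (Function.update (fun _ : Fin (n + 1) => LinearMap.id) 0
    (LinearMap.mulRight k c ∘ₗ τ.toLinearMap))

theorem capChain_tprod (τ : A ≃ₐ[k] A) (n : ℕ) (c : A) (a : Fin (n + 1) → A) :
    capChain τ n c (PiTensorProduct.tprod k a) =
      PiTensorProduct.tprod k (Function.update a 0 (τ (a 0) * c)) := by
  rw [capChain, PiTensorProduct.map_tprod]
  congr 1
  funext i
  refine Fin.cases ?_ (fun i => ?_) i <;> simp [Fin.ext_iff]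

/-- The cap product with a `τ`-central element is compatible with the boundaries. -/
theorem boundary_capChain (σ τ : A ≃ₐ[k] A) (n : ℕ) {c : A} (hc : c ∈ HZero τ) :
    boundary (τ * σ) n ∘ₗ capChain τ (n + 1) c = capChain τ n c ∘ₗ boundary σ n := by
  rw [mem_HZero] at hc
  ext a
  simp only [LinearMap.compMultilinearMap_apply, LinearMap.comp_apply, capChain_tprod,
    boundary_tprod, map_add, map_sum, map_smul]
  congr 1
  · refine Finset.sum_congr rfl fun i _ => ?_
    congr 2
    funext j
    refine Fin.cases ?_ (fun j => ?_) j
    · refine Fin.cases ?_ (fun i => ?_) i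
      · simp [Fin.contractNth, mul_assoc, hc]
      · simp [Fin.contractNth]
    · simp [Fin.contractNth]
  · congr 2
    funext j
    refine Fin.cases ?_ (fun j => ?_) j
    · simp [mul_assoc]
    · simp

theorem capChain_mem_cycles (σ τ : A ≃ₐ[k] A) (n : ℕ) {c : A} (hc : c ∈ HZero τ) :
    cycles σ n ≤ (cycles (τ * σ) n).comap (capChain τ n c) := by
  cases n with
  | zero => exact fun _ _ => trivial
  | succ n =>
    intro z hz
    have := LinearMap.congr_fun (boundary_capChain σ τ n hc) z
    rw [LinearMap.comp_apply, LinearMap.comp_apply, LinearMap.mem_ker.1 hz, map_zero] at this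
    exact this

theorem capChain_mem_boundaries (σ τ : A ≃ₐ[k] A) (n : ℕ) {c : A} (hc : c ∈ HZero τ) :
    boundaries σ n ≤ (boundaries (τ * σ) n).comap (capChain τ n c) := by
  rintro _ ⟨y, rfl⟩
  exact ⟨capChain τ (n + 1) c y, LinearMap.congr_fun (boundary_capChain σ τ n hc) y⟩

/-- The cap product `H_n(A, σA) ⊗ H^0(A, τA) → H_n(A, τσA)`, `[z] ↦ [z ⌢ c]`. -/
def capHomology (σ τ : A ≃ₐ[k] A) (n : ℕ) (c : HZero τ) : Homology σ n →ₗ[k] Homology (τ * σ) n :=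
  Submodule.mapQ _ _ ((capChain τ n (c : A)).restrict (capChain_mem_cycles σ τ n c.2))
    (fun _ hz => capChain_mem_boundaries σ τ n c.2 hz)

theorem capHomology_mk (σ τ : A ≃ₐ[k] A) (n : ℕ) (c : HZero τ) (z : cycles σ n) :
    capHomology σ τ n c (homologyClass σ n z) =
      homologyClass _ n ⟨capChain τ n c z, capChain_mem_cycles σ τ n c.2 z.2⟩ := rfl

theorem capChain_add (τ : A ≃ₐ[k] A) (n : ℕ) (c d : A) :
    capChain τ n (c + d) = capChain τ n c + capChain τ n d := by
  ext a
  simp [capChain_tprod, mul_add]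

theorem capChain_smul (τ : A ≃ₐ[k] A) (n : ℕ) (r : k) (c : A) :
    capChain τ n (r • c) = r • capChain τ n c := by
  ext a
  simp [capChain_tprod]

theorem capHomology_add (σ τ : A ≃ₐ[k] A) (n : ℕ) (c d : HZero τ) :
    capHomology σ τ n (c + d) = capHomology σ τ n c + capHomology σ τ n d := by
  ext x
  obtain ⟨z, rfl⟩ := homologyClass_surjective σ n x
  rw [LinearMap.add_apply, capHomology_mk, capHomology_mk, capHomology_mk, ← map_add]
  congr 1
  exact Subtype.ext (LinearMap.congr_fun (capChain_add τ n (c : A) d) z)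

theorem capHomology_smul (σ τ : A ≃ₐ[k] A) (n : ℕ) (r : k) (c : HZero τ) :
    capHomology σ τ n (r • c) = r • capHomology σ τ n c := by
  ext x
  obtain ⟨z, rfl⟩ := homologyClass_surjective σ n x
  rw [LinearMap.smul_apply, capHomology_mk, capHomology_mk, ← map_smul]
  congr 1
  exact Subtype.ext (LinearMap.congr_fun (capChain_smul τ n r (c : A)) z)

theorem capChain_capChain (τ υ : A ≃ₐ[k] A) (n : ℕ) (c d : A) (z : Chain k A n) :
    capChain υ n d (capChain τ n c z) = capChain (υ * τ) n (υ c * d) z := by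
  have : capChain υ n d ∘ₗ capChain τ n c = capChain (υ * τ) n (υ c * d) := by
    ext a
    simp [capChain_tprod, mul_assoc]
  exact LinearMap.congr_fun this z

variable (k A) in
/-- The sum `⨁_σ H_n(A, σA)`, ranging over all `σ ∈ Aut(A)`. -/
def TwistedHomology (n : ℕ) : Type _ := ⨁ σ : A ≃ₐ[k] A, Homology σ n

instance (n : ℕ) : AddCommGroup (TwistedHomology k A n) :=
  inferInstanceAs (AddCommGroup (⨁ σ : A ≃ₐ[k] A, Homology σ n))

instance (n : ℕ) : Module k (TwistedHomology k A n) :=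
  inferInstanceAs (Module k (⨁ σ : A ≃ₐ[k] A, Homology σ n))

open Classical in
/-- The inclusion of the summand `H_n(A, σA)`. -/
def TwistedHomology.of (σ : A ≃ₐ[k] A) (n : ℕ) : Homology σ n →ₗ[k] TwistedHomology k A n :=
  DirectSum.lof k (A ≃ₐ[k] A) (fun σ => Homology σ n) σ

open Classical in
/-- The cap product `(⨁_σ H_n(A, σA)) ⊗ Λ⁰(A) → ⨁_σ H_n(A, σA)`. -/
def cap (n : ℕ) :
    TwistedHomology k A n →ₗ[k] TwistedCentre k A →ₗ[k] TwistedHomology k A n :=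
  DirectSum.toModule k (A ≃ₐ[k] A) (TwistedCentre k A →ₗ[k] TwistedHomology k A n) fun σ =>
    LinearMap.flip (DirectSum.toModule k (Idx k A) (Homology σ n →ₗ[k] TwistedHomology k A n)
      fun i =>
        { toFun := fun c => TwistedHomology.of _ n ∘ₗ capHomology σ (MulOpposite.unop i.toMul) n c
          map_add' := fun c d => by
            rw [capHomology_add, LinearMap.comp_add]
          map_smul' := fun r c => by
            rw [capHomology_smul, LinearMap.comp_smul, RingHom.id_apply] })

theorem cap_of_of (n : ℕ) {σ τ : A ≃ₐ[k] A} (x : Homology σ n) (c : HZero τ) :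
    cap n (TwistedHomology.of σ n x) (TwistedCentre.of τ c) =
      TwistedHomology.of (τ * σ) n (capHomology σ τ n c x) := by
  classical
  unfold cap TwistedHomology.of TwistedCentre.of
  erw [DirectSum.toModule_lof, LinearMap.flip_apply, DirectSum.toModule_lof]
  rfl

theorem TwistedHomology.induction {n : ℕ} {P : TwistedHomology k A n → Prop}
    (x : TwistedHomology k A n) (zero : P 0) (of : ∀ σ z, P (.of σ n (homologyClass σ n z)))
    (add : ∀ x y, P x → P y → P (x + y)) : P x := by
  classical
  refine DirectSum.induction_on (β := fun σ : A ≃ₐ[k] A => Homology σ n) (motive := P) x zero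
    (fun σ x => ?_) (fun x y hx hy => add x y hx hy)
  obtain ⟨z, rfl⟩ := homologyClass_surjective σ n x
  exact of σ z

theorem TwistedCentre.induction {P : TwistedCentre k A → Prop}
    (f : TwistedCentre k A) (zero : P 0) (of : ∀ σ a, P (.of σ a))
    (add : ∀ f g, P f → P g → P (f + g)) : P f := by
  classical
  exact DirectSum.induction_on (β := HZeroPiece (k := k) (A := A)) (motive := P) f zero
    (fun i a => of (MulOpposite.unop i.toMul) a) (fun x y hx hy => add x y hx hy)

theorem cap_one (n : ℕ) (x : TwistedHomology k A n) : cap n x 1 = x := by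
  induction x using TwistedHomology.induction with
  | zero => simp
  | of σ z =>
    rw [TwistedCentre.one_def, cap_of_of, capHomology_mk]
    have : capChain (1 : A ≃ₐ[k] A) n 1 = LinearMap.id := by
      ext a
      simp [capChain_tprod]
    change TwistedHomology.of σ n (homologyClass σ n ⟨capChain 1 n 1 z, _⟩) = _
    congr 2
    exact Subtype.ext (LinearMap.congr_fun this z)
  | add x y hx hy => rw [map_add, LinearMap.add_apply, hx, hy]

theorem cap_cap (n : ℕ) (x : TwistedHomology k A n) (f g : TwistedCentre k A) :
    cap n (cap n x f) g = cap n x (f * g) := by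
  induction x using TwistedHomology.induction with
  | zero => simp
  | add x y hx hy => simp only [map_add, LinearMap.add_apply, hx, hy]
  | of σ z =>
    induction f using TwistedCentre.induction with
    | zero => simp
    | add f f' hf hf' => simp only [map_add, LinearMap.add_apply, add_mul, hf, hf']
    | of τ a =>
      induction g using TwistedCentre.induction with
      | zero => simp
      | add g g' hg hg' => simp only [map_add, mul_add, hg, hg']
      | of υ b =>
        rw [cap_of_of, cap_of_of, TwistedCentre.of_mul_of, cap_of_of, capHomology_mk,
          capHomology_mk, capHomology_mk]
        change TwistedHomology.of (υ * τ * σ) n (homologyClass (υ * τ * σ) n _) = _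
        congr 2
        exact Subtype.ext (capChain_capChain τ υ n a b z)

/-- `⨁_σ H_n(A, σA)` is a right module over the twisted centre through the cap product. -/
instance (n : ℕ) : Module (TwistedCentre k A)ᵐᵒᵖ (TwistedHomology k A n) where
  smul f x := cap n x f.unop
  one_smul x := cap_one n x
  mul_smul _ _ x := (cap_cap n x _ _).symm
  smul_zero _ := LinearMap.congr_fun (map_zero (cap n)) _
  smul_add _ x y := LinearMap.congr_fun (map_add (cap n) x y) _
  add_smul _ _ x := map_add (cap n x) _ _
  zero_smul x := map_zero (cap n x)

theorem op_smul_eq_cap (n : ℕ) (f : TwistedCentre k A) (x : TwistedHomology k A n) :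
    MulOpposite.op f • x = cap n x f := rfl

variable (k A) in
/-- The chain `a ⊗ b ∈ C_1`, bilinear in `a` and `b`. -/
def tensor₂ : A →ₗ[k] A →ₗ[k] Chain k A 1 :=
  LinearMap.mk₂ k (fun a b => PiTensorProduct.tprod k ![a, b])
    (fun a a' b => by
      simpa only [update_pair_zero] using
        (PiTensorProduct.tprod k (s := fun _ : Fin 2 => A)).map_update_add ![a, b] 0 a a')
    (fun c a b => by
      simpa only [update_pair_zero] using
        (PiTensorProduct.tprod k (s := fun _ : Fin 2 => A)).map_update_smul ![a, b] 0 c a)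
    (fun a b b' => by
      simpa only [update_pair_one] using
        (PiTensorProduct.tprod k (s := fun _ : Fin 2 => A)).map_update_add ![a, b] 1 b b')
    (fun c a b => by
      simpa only [update_pair_one] using
        (PiTensorProduct.tprod k (s := fun _ : Fin 2 => A)).map_update_smul ![a, b] 1 c b)

variable (k) in
/-- The chain `a ⊗ b ⊗ c ∈ C_2`. -/
def tensor₃ (a b c : A) : Chain k A 2 := PiTensorProduct.tprod k ![a, b, c]

theorem boundary_tensor₃ (σ : A ≃ₐ[k] A) (a b c : A) :
    boundary σ 1 (tensor₃ k a b c) =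
      tensor₂ k A (a * b) c - tensor₂ k A a (b * c) + tensor₂ k A (σ c * a) b := by
  have h0 : Fin.contractNth (0 : Fin 3) (· * ·) ![a, b, c] = ![a * b, c] := by
    funext i; fin_cases i <;> rfl
  have h1 : Fin.contractNth (1 : Fin 3) (· * ·) ![a, b, c] = ![a, b * c] := by
    funext i; fin_cases i <;> rfl
  have h2 : (Fin.cons (σ (![a, b, c] (Fin.last 2)) * ![a, b, c] 0)
      (fun j : Fin 1 => ![a, b, c] j.succ.castSucc) : Fin 2 → A) = ![σ c * a, b] := by
    funext i; fin_cases i <;> rfl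
  rw [tensor₃, boundary_tprod, h2, Fin.sum_univ_two]
  simp [h0, h1, tensor₂, sub_eq_add_neg]

end General
end TwistedHochschild

namespace Podles
open TwistedHochschild

/-- Indices of the generators `x₋₁, x₀, x₁`. -/
inductive Gen
  | neg
  | zero
  | pos

/-- The defining relations of the standard Podleś quantum 2-sphere,
`x_{±1} x₀ = q^{∓2} x₀ x_{±1}` and `x_{±1} x_{∓1} = q^{∓2} x₀² + q^{∓1} x₀`. -/
inductive Rel (q : ℂˣ) : FreeAlgebra ℂ Gen → FreeAlgebra ℂ Gen → Prop
  | pos_zero : Rel q (FreeAlgebra.ι ℂ .pos * FreeAlgebra.ι ℂ .zero)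
      ((q : ℂ)⁻¹ ^ 2 • (FreeAlgebra.ι ℂ .zero * FreeAlgebra.ι ℂ .pos))
  | neg_zero : Rel q (FreeAlgebra.ι ℂ .neg * FreeAlgebra.ι ℂ .zero)
      ((q : ℂ) ^ 2 • (FreeAlgebra.ι ℂ .zero * FreeAlgebra.ι ℂ .neg))
  | pos_neg : Rel q (FreeAlgebra.ι ℂ .pos * FreeAlgebra.ι ℂ .neg)
      ((q : ℂ)⁻¹ ^ 2 • FreeAlgebra.ι ℂ .zero ^ 2 + (q : ℂ)⁻¹ • FreeAlgebra.ι ℂ .zero)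
  | neg_pos : Rel q (FreeAlgebra.ι ℂ .neg * FreeAlgebra.ι ℂ .pos)
      ((q : ℂ) ^ 2 • FreeAlgebra.ι ℂ .zero ^ 2 + (q : ℂ) • FreeAlgebra.ι ℂ .zero)

end Podles

/-- The standard Podleś quantum 2-sphere: the universal `ℂ`-algebra with generators
`x₋₁, x₀, x₁` and the relations `Podles.Rel q`. -/
def Podles (q : ℂˣ) : Type := RingQuot (Podles.Rel q)

namespace Podles
open TwistedHochschild

variable {q : ℂˣ}

instance : Ring (Podles q) := inferInstanceAs (Ring (RingQuot (Rel q)))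
instance : Algebra ℂ (Podles q) := inferInstanceAs (Algebra ℂ (RingQuot (Rel q)))

variable (q) in
/-- The quotient map from the free algebra. -/
def mk : FreeAlgebra ℂ Gen →ₐ[ℂ] Podles q := RingQuot.mkAlgHom ℂ (Rel q)

theorem mk_rel {a b : FreeAlgebra ℂ Gen} (h : Rel q a b) : mk q a = mk q b :=
  RingQuot.mkAlgHom_rel ℂ h

theorem mk_surjective : Function.Surjective (mk q) := RingQuot.mkAlgHom_surjective ℂ (Rel q)

variable (q) in
/-- The generators `x₋₁, x₀, x₁`. -/
def x (i : Gen) : Podles q := mk q (FreeAlgebra.ι ℂ i)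

theorem x_pos_zero : x q .pos * x q .zero = (q : ℂ)⁻¹ ^ 2 • (x q .zero * x q .pos) := by
  simpa only [x, map_mul, map_smul] using mk_rel (Rel.pos_zero (q := q))

theorem x_neg_zero : x q .neg * x q .zero = (q : ℂ) ^ 2 • (x q .zero * x q .neg) := by
  simpa only [x, map_mul, map_smul] using mk_rel (Rel.neg_zero (q := q))

theorem x_pos_neg : x q .pos * x q .neg =
    (q : ℂ)⁻¹ ^ 2 • x q .zero ^ 2 + (q : ℂ)⁻¹ • x q .zero := by
  simpa only [x, map_mul, map_smul, map_add, map_pow] using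
    mk_rel (Rel.pos_neg (q := q))

theorem x_neg_pos : x q .neg * x q .pos =
    (q : ℂ) ^ 2 • x q .zero ^ 2 + (q : ℂ) • x q .zero := by
  simpa only [x, map_mul, map_smul, map_add, map_pow] using
    mk_rel (Rel.neg_pos (q := q))

/-- The weights `l⁻¹, 1, l` of `x₋₁, x₀, x₁`. -/
def weight (l : ℂˣ) : Gen → ℂ
  | .neg => (l : ℂ)⁻¹
  | .zero => 1
  | .pos => l

/-- The endomorphism `xₙ ↦ lⁿ xₙ`. -/
def scaleHom (l : ℂˣ) : Podles q →ₐ[ℂ] Podles q :=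
  RingQuot.liftAlgHom ℂ ⟨FreeAlgebra.lift ℂ fun i => weight l i • x q i, by
    rintro _ _ (_ | _ | _ | _)
    · simp [weight, x_pos_zero, smul_smul, mul_comm]
    · simp [weight, x_neg_zero, smul_smul, mul_comm]
    · simp [weight, x_pos_neg]
    · simp [weight, x_neg_pos]⟩

@[simp] theorem scaleHom_x (l : ℂˣ) (i : Gen) : scaleHom l (x q i) = weight l i • x q i := by
  refine (RingQuot.liftAlgHom_mkAlgHom_apply ℂ _ _ _).trans ?_
  simp

theorem algHom_ext {B : Type*} [Semiring B] [Algebra ℂ B] {f g : Podles q →ₐ[ℂ] B}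
    (h : ∀ i, f (x q i) = g (x q i)) : f = g :=
  RingQuot.ringQuot_ext' ℂ _ _ (FreeAlgebra.hom_ext (funext h))

/-- The automorphism `σ_l`, `σ_l(xₙ) = lⁿ xₙ`. -/
def scale (l : ℂˣ) : Podles q ≃ₐ[ℂ] Podles q :=
  AlgEquiv.ofAlgHom (scaleHom l) (scaleHom l⁻¹)
    (algHom_ext fun i => by cases i <;> simp [weight, smul_smul])
    (algHom_ext fun i => by cases i <;> simp [weight, smul_smul])

@[simp] theorem scale_x (l : ℂˣ) (i : Gen) : scale l (x q i) = weight l i • x q i :=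
  scaleHom_x l i

variable (q) in
/-- The modular automorphism, `σ_mod(xₙ) = q^{2n} xₙ`. -/
def sigmaMod : Podles q ≃ₐ[ℂ] Podles q := scale (q ^ 2)

/-- `x₀` is `σ_mod`-central. -/
theorem x_zero_mem : x q .zero ∈ HZero (sigmaMod q) := by
  rw [mem_HZero]
  intro b
  have hq : (q : ℂ) ≠ 0 := q.ne_zero
  obtain ⟨b, rfl⟩ := mk_surjective b
  induction b using FreeAlgebra.induction with
  | grade0 r => simp only [AlgHom.commutes, AlgEquiv.commutes]; exact (Algebra.commutes r _).symm
  | grade1 i =>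
    change x q .zero * x q i = sigmaMod q (x q i) * x q .zero
    cases i <;> simp [sigmaMod, weight, x_neg_zero, x_pos_zero, smul_smul, hq]
  | mul a b ha hb => simp only [map_mul]; rw [← mul_assoc, ha, mul_assoc, hb, mul_assoc]
  | add a b ha hb => simp only [map_add, mul_add, add_mul, ha, hb]

variable (q) in
/-- `x₀` as an element of `H^0(A, σ_mod A)` in the twisted centre. -/
def xZero : TwistedCentre ℂ (Podles q) := .of (sigmaMod q) ⟨x q .zero, x_zero_mem⟩

variable (q) in
/-- The chain `dA`. -/
def dChain : Chain ℂ (Podles q) 2 :=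
  let t := tensor₃ ℂ (A := Podles q)
  (2 : ℂ) • (t (x q .pos) (x q .neg) (x q .zero) - (q : ℂ) ^ 2 • t (x q .pos) (x q .zero) (x q .neg))
  + (2 : ℂ) • ((q : ℂ)⁻¹ ^ 2 • t (x q .neg) (x q .zero) (x q .pos)
      - t (x q .neg) (x q .pos) (x q .zero))
  + ((q : ℂ) • t 1 (x q .pos) (x q .neg) - (q : ℂ)⁻¹ • t 1 (x q .neg) (x q .pos)
      + ((q : ℂ) - (q : ℂ)⁻¹) • t 1 (x q .zero) (x q .zero))
  + (2 : ℂ) • (t (x q .zero) (x q .pos) (x q .neg) - t (x q .zero) (x q .neg) (x q .pos)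
      + ((q : ℂ) ^ 2 - (q : ℂ)⁻¹ ^ 2) • t (x q .zero) (x q .zero) (x q .zero))

theorem dChain_mem : dChain q ∈ cycles (sigmaMod q) 2 := by
  have hq : (q : ℂ) ≠ 0 := q.ne_zero
  change boundary (sigmaMod q) 1 (dChain q) = 0
  simp only [dChain, map_add, map_sub, map_smul, boundary_tensor₃, sigmaMod, scale_x, weight,
    x_pos_zero, x_neg_zero, x_pos_neg, x_neg_pos, smul_mul_assoc, one_mul, mul_one, one_smul,
    LinearMap.add_apply, LinearMap.smul_apply, ← pow_two, Units.val_pow_eq_pow_val]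
  match_scalars <;> field_simp <;> ring

variable (q) in
/-- The fundamental class `[dA] ∈ H_2(A, σ_mod A)`, as an element of `⨁_σ H_2(A, σA)`. -/
def fundamentalClass : TwistedHomology ℂ (Podles q) 2 :=
  .of (sigmaMod q) 2 (homologyClass (sigmaMod q) 2 ⟨dChain q, dChain_mem⟩)

variable (q) in
/-- The `ℂ[X]`-module structure on `⨁_σ H_2(A, σA)` with `f • ω = ω ⌢ f(x₀)`. -/
instance polynomialModule : Module (Polynomial ℂ) (TwistedHomology ℂ (Podles q) 2) :=
  Module.compHom _ (Polynomial.aeval (R := ℂ) (MulOpposite.op (xZero q))).toRingHom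

theorem polynomial_smul (f : Polynomial ℂ) (ω : TwistedHomology ℂ (Podles q) 2) :
    f • ω = cap 2 ω (Polynomial.aeval (xZero q) f) := by
  change cap 2 ω (Polynomial.aeval (MulOpposite.op (xZero q)) f).unop = _
  congr 1
  induction f using Polynomial.induction_on' with
  | add f g hf hg => rw [map_add, map_add, MulOpposite.unop_add, hf, hg]
  | monomial n c =>
    rw [Polynomial.aeval_monomial, Polynomial.aeval_monomial, MulOpposite.unop_mul,
      MulOpposite.unop_pow, MulOpposite.unop_op, MulOpposite.algebraMap_apply,
      MulOpposite.unop_op, Algebra.commutes]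

end Podles

end

set_option linter.unusedSimpArgs false

noncomputable section

/-! ### Low-degree Hochschild chains as multilinear expressions. -/

namespace TwistedHochschild

/-! The sphere `A` embeds into the skew Laurent algebra `ℂ[X][y, y⁻¹]`, `yX = q⁻²Xy`, by `x₀ ↦ X`,
`x₁ ↦ y`, `x₋₁ ↦ (q²X² + qX)y⁻¹` (`toSkewLaurent_injective`). The same computation gives the
Poincaré–Birkhoff–Witt basis `pbwBasis`.

Generation of `H₂` by `[dA]`. The basis yields a partial contraction `C₁ → C₂`, as in an Anick-type
resolution. Together with `chain_decomposition` it pushes every 2-cycle, modulo boundaries, onto the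
four defining relations (`exists_relChain_of_cycle`). Such a cycle is a quadruple `(u₁, u₂, v₁, v₂)`
subject to three linear equations. The overlaps of the relations provide syzygies, that is,
quadruples whose chains are boundaries. For a cycle, the element `dualPairing` of `A` is
`σσ_mod⁻¹`-central by direct identities, and the cycle differs from the cap product of `dA` with
that element by a sum of syzygies (`relChain_sub_mem_boundaries`). Hence every class is `[dA] ⌢ c`
with `c` twisted central.

Twisted centre. In the Laurent algebra, comparing `y`-degrees in `τ(b)c = cb` for the generators `b`
forces a nonzero `c` to be a multiple of some `x₀ⁿ`, and then `τ = σ_modⁿ`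
(`exists_eq_smul_x_zero_pow`). Here `q` must not be a root of unity.

Uniqueness. The coefficient of `Xⁿy⁰` is a trace twisted by `σ_modⁿ`. With the derivations `X∂/∂X`
and `y∂/∂y` it gives a twisted 2-cocycle (`cocycle_boundary`) which takes the value `-1` on `dA` for
`n = 1` and is compatible with capping by powers of `x₀` (`cocycle_capChain`). Since the powers of
`σ_mod` are distinct, these cocycles recover every coefficient of `f` from `[dA] ⌢ f(x₀)`
(`detect_cap`). This gives freeness, and also the injectivity of evaluation at `x₀`. -/

theorem update_triple_zero {A : Type*} (a b c y : A) :
    Function.update ![a, b, c] 0 y = ![y, b, c] := by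
  funext i; fin_cases i <;> rfl

theorem update_triple_one {A : Type*} (a b c y : A) :
    Function.update ![a, b, c] 1 y = ![a, y, c] := by
  funext i; fin_cases i <;> rfl

theorem update_triple_two {A : Type*} (a b c y : A) :
    Function.update ![a, b, c] 2 y = ![a, b, y] := by
  funext i; fin_cases i <;> rfl

section General
variable {k A : Type*} [CommRing k] [Ring A] [Algebra k A]

variable (k A) in
/-- The chain `a ⊗ b ⊗ c`, trilinear in its arguments. -/
def tensor₃Lin : A →ₗ[k] A →ₗ[k] A →ₗ[k] Chain k A 2 :=
  LinearMap.mk₂ k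
    (fun a b =>
      { toFun := fun c => tensor₃ k a b c
        map_add' := fun c c' => by
          simpa [tensor₃, update_triple_two] using
            (PiTensorProduct.tprod k (s := fun _ : Fin 3 => A)).map_update_add ![a, b, c] 2 c c'
        map_smul' := fun r c => by
          simpa [tensor₃, update_triple_two] using
            (PiTensorProduct.tprod k (s := fun _ : Fin 3 => A)).map_update_smul ![a, b, c] 2 r c })
    (fun a a' b => by
      ext c
      simpa [tensor₃, update_triple_zero] using
        (PiTensorProduct.tprod k (s := fun _ : Fin 3 => A)).map_update_add ![a, b, c] 0 a a')
    (fun r a b => by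
      ext c
      simpa [tensor₃, update_triple_zero] using
        (PiTensorProduct.tprod k (s := fun _ : Fin 3 => A)).map_update_smul ![a, b, c] 0 r a)
    (fun a b b' => by
      ext c
      simpa [tensor₃, update_triple_one] using
        (PiTensorProduct.tprod k (s := fun _ : Fin 3 => A)).map_update_add ![a, b, c] 1 b b')
    (fun r a b => by
      ext c
      simpa [tensor₃, update_triple_one] using
        (PiTensorProduct.tprod k (s := fun _ : Fin 3 => A)).map_update_smul ![a, b, c] 1 r b)

theorem tensor₃Lin_apply (a b c : A) : tensor₃Lin k A a b c = tensor₃ k a b c := rfl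

theorem boundary_tensor₄ (σ : A ≃ₐ[k] A) (a b c d : A) :
    boundary σ 2 (PiTensorProduct.tprod k ![a, b, c, d]) =
      tensor₃ k (a * b) c d - tensor₃ k a (b * c) d + tensor₃ k a b (c * d)
        - tensor₃ k (σ d * a) b c := by
  have h0 : Fin.contractNth (0 : Fin 4) (· * ·) ![a, b, c, d] = ![a * b, c, d] := by
    funext i; fin_cases i <;> rfl
  have h1 : Fin.contractNth (1 : Fin 4) (· * ·) ![a, b, c, d] = ![a, b * c, d] := by
    funext i; fin_cases i <;> rfl
  have h2 : Fin.contractNth (2 : Fin 4) (· * ·) ![a, b, c, d] = ![a, b, c * d] := by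
    funext i; fin_cases i <;> rfl
  have h3 : (Fin.cons (σ (![a, b, c, d] (Fin.last 3)) * ![a, b, c, d] 0)
      (fun j : Fin 2 => ![a, b, c, d] j.succ.castSucc) : Fin 3 → A) = ![σ d * a, b, c] := by
    funext i; fin_cases i <;> rfl
  rw [boundary_tprod, h3, Fin.sum_univ_three]
  simp [h0, h1, h2, tensor₃, sub_eq_add_neg, pow_succ]

/-- The class of `a ⊗ b ⊗ c` modulo boundaries. -/
def tensorClass (σ : A ≃ₐ[k] A) : A →ₗ[k] A →ₗ[k] A →ₗ[k] (Chain k A 2 ⧸ boundaries σ 2) :=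
  LinearMap.compr₂ (tensor₃Lin k A) (LinearMap.llcomp k A _ _ (boundaries σ 2).mkQ)

theorem tensorClass_apply (σ : A ≃ₐ[k] A) (a b c : A) :
    tensorClass σ a b c = (boundaries σ 2).mkQ (tensor₃ k a b c) := rfl

/-- The vanishing of the class of `b(a ⊗ b ⊗ c ⊗ d)`, solved for the term with a product in the
middle, so that it can serve as a rewriting rule. -/
theorem tensorClass_mul (σ : A ≃ₐ[k] A) (a b c d : A) :
    tensorClass σ a (b * c) d =
      tensorClass σ (a * b) c d + tensorClass σ a b (c * d) - tensorClass σ (σ d * a) b c := by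
  have : (boundaries σ 2).mkQ (boundary σ 2 (PiTensorProduct.tprod k ![a, b, c, d])) = 0 :=
    (Submodule.Quotient.mk_eq_zero _).2 ⟨_, rfl⟩
  rw [boundary_tensor₄] at this
  simp only [map_add, map_sub, ← tensorClass_apply] at this
  rw [← sub_eq_zero, ← neg_eq_zero, ← this]
  abel

/-- The linear map on `C_1` induced by a bilinear map. -/
def liftChain₁ {N : Type*} [AddCommGroup N] [Module k N] (B : A →ₗ[k] A →ₗ[k] N) :
    Chain k A 1 →ₗ[k] N :=
  PiTensorProduct.lift
    { toFun := fun a => B (a 0) (a 1)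
      map_update_add' := fun a m x y => by
        rename_i D
        rw [Subsingleton.elim D (instDecidableEqFin _)]
        fin_cases m <;> simp
      map_update_smul' := fun a m c x => by
        rename_i D
        rw [Subsingleton.elim D (instDecidableEqFin _)]
        fin_cases m <;> simp }

theorem liftChain₁_tensor₂ {N : Type*} [AddCommGroup N] [Module k N] (B : A →ₗ[k] A →ₗ[k] N)
    (a b : A) : liftChain₁ B (tensor₂ k A a b) = B a b := by
  simp [liftChain₁, tensor₂, PiTensorProduct.lift.tprod]

theorem span_tensor₃ (S : Submodule k (Chain k A 2)) (h : ∀ a b c, tensor₃ k a b c ∈ S) :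
    S = ⊤ := by
  rw [eq_top_iff, ← PiTensorProduct.span_tprod_eq_top, Submodule.span_le]
  rintro _ ⟨a, rfl⟩
  have : a = ![a 0, a 1, a 2] := by funext i; fin_cases i <;> rfl
  rw [this]
  exact h _ _ _

theorem capChain_tensor₃ (τ : A ≃ₐ[k] A) (c m a b : A) :
    capChain τ 2 c (tensor₃ k m a b) = tensor₃ k (τ m * c) a b := by
  rw [tensor₃, capChain_tprod, tensor₃]
  congr 1
  funext i; fin_cases i <;> rfl

end General
end TwistedHochschild

/-! ### The skew Laurent model and the Poincaré–Birkhoff–Witt basis. -/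

namespace Podles
open TwistedHochschild

/-- The polynomial ring `ℂ[X]`, on which `ℤ` acts through `X ↦ q⁻² X`. -/
def ScaledPolynomial (_q : ℂˣ) : Type := ℂ[X]

variable {q : ℂˣ}

instance : CommRing (ScaledPolynomial q) := inferInstanceAs (CommRing ℂ[X])
instance : Algebra ℂ (ScaledPolynomial q) := inferInstanceAs (Algebra ℂ ℂ[X])

variable (q) in
/-- The substitution `X ↦ q^{-2n} X`. -/
def scaleX (n : ℤ) : ℂ[X] →ₐ[ℂ] ℂ[X] :=
  Polynomial.aeval (Polynomial.C ((q : ℂ) ^ (-2 * n)) * Polynomial.X)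

theorem scaleX_zero (f : ℂ[X]) : scaleX q 0 f = f := by
  simp [scaleX]

theorem scaleX_X (n : ℤ) :
    scaleX q n Polynomial.X = Polynomial.C ((q : ℂ) ^ (-2 * n)) * Polynomial.X := by
  simp [scaleX]

theorem scaleX_add (m n : ℤ) (f : ℂ[X]) : scaleX q (m + n) f = scaleX q m (scaleX q n f) := by
  have : scaleX q (m + n) = (scaleX q m).comp (scaleX q n) := by
    refine Polynomial.algHom_ext ?_
    have hq : (q : ℂ) ≠ 0 := q.ne_zero
    rw [AlgHom.comp_apply, scaleX_X, scaleX_X, map_mul, scaleX_X, ← Polynomial.algebraMap_eq,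
      AlgHom.commutes, ← mul_assoc, ← map_mul, ← zpow_add₀ hq]
    congr 3
    ring
  rw [this]; rfl

theorem coeff_scaleX (n : ℤ) (f : ℂ[X]) (i : ℕ) :
    (scaleX q n f).coeff i = (q : ℂ) ^ (-2 * n * i) * f.coeff i := by
  induction f using Polynomial.induction_on' with
  | add f g hf hg => simp [hf, hg, mul_add]
  | monomial m c =>
    rw [scaleX, Polynomial.aeval_monomial, mul_pow, ← Polynomial.C_pow, Polynomial.algebraMap_eq,
      ← mul_assoc, ← Polynomial.C_mul, Polynomial.coeff_C_mul_X_pow, Polynomial.coeff_monomial]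
    by_cases h : i = m
    · subst h; rw [if_pos rfl, if_pos rfl, zpow_mul _ _ (i : ℤ), zpow_natCast, mul_comm]
    · rw [if_neg h, if_neg (Ne.symm h), mul_zero]

theorem eval_scaleX (n : ℤ) (f : ℂ[X]) (r : ℂ) :
    (scaleX q n f).eval r = f.eval ((q : ℂ) ^ (-2 * n) * r) := by
  rw [scaleX, ← Polynomial.coe_evalRingHom, ← Polynomial.coe_aeval_eq_evalRingHom,
    AlgHom.coe_toRingHom, Polynomial.aeval_def, ← Polynomial.aeval_def,
    ← Polynomial.aeval_algHom_apply]
  simp [Polynomial.aeval_def]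

theorem scaleX_ne_zero (n : ℤ) {f : ℂ[X]} (hf : f ≠ 0) : scaleX q n f ≠ 0 := by
  intro h
  apply hf
  have := scaleX_add (q := q) (-n) n f
  rwa [neg_add_cancel, scaleX_zero, h, map_zero] at this

instance : MulSemiringAction (Multiplicative ℤ) (ScaledPolynomial q) where
  smul n f := scaleX q n.toAdd f
  one_smul f := scaleX_zero f
  mul_smul m n f := scaleX_add m.toAdd n.toAdd f
  smul_zero n := map_zero (scaleX q n.toAdd)
  smul_add n := map_add (scaleX q n.toAdd)
  smul_one n := map_one (scaleX q n.toAdd)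
  smul_mul n := map_mul (scaleX q n.toAdd)

instance : SMulCommClass (Multiplicative ℤ) ℂ (ScaledPolynomial q) where
  smul_comm n c f := map_smul (scaleX q n.toAdd) c f

variable (q) in
/-- The skew Laurent polynomial algebra `ℂ[X][y, y⁻¹]` with `y X = q⁻² X y`. -/
abbrev SkewLaurent : Type := SkewMonoidAlgebra (ScaledPolynomial q) (Multiplicative ℤ)

namespace SkewLaurent

variable (q) in
/-- The element `f(X) yⁿ`. -/
def mono (n : ℤ) : ℂ[X] →ₗ[ℂ] SkewLaurent q where
  toFun f := SkewMonoidAlgebra.single (Multiplicative.ofAdd n) (show ScaledPolynomial q from f)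
  map_add' _ _ := SkewMonoidAlgebra.single_add _ _ _
  map_smul' c _ := (SkewMonoidAlgebra.smul_single (k := ScaledPolynomial q) c _ _).symm

variable (q) in
/-- The coefficient of `yⁿ`. -/
def cf (n : ℤ) : SkewLaurent q →ₗ[ℂ] ℂ[X] where
  toFun a := SkewMonoidAlgebra.coeff a (Multiplicative.ofAdd n)
  map_add' a b := by rw [SkewMonoidAlgebra.coeff_add]; rfl
  map_smul' c f := by rw [SkewMonoidAlgebra.coeff_smul]; rfl

theorem mono_mul_mono (m n : ℤ) (f g : ℂ[X]) :
    mono q m f * mono q n g = mono q (m + n) (f * scaleX q m g) :=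
  SkewMonoidAlgebra.single_mul_single

theorem one_eq : (1 : SkewLaurent q) = mono q 0 1 := rfl

theorem cf_mono (m n : ℤ) (f : ℂ[X]) : cf q m (mono q n f) = if n = m then f else 0 := by
  classical
  exact (SkewMonoidAlgebra.coeff_single_apply).trans (by simp)

theorem ext {a b : SkewLaurent q} (h : ∀ n, cf q n a = cf q n b) : a = b :=
  SkewMonoidAlgebra.ext fun n => h n.toAdd

theorem induction {P : SkewLaurent q → Prop} (a : SkewLaurent q) (zero : P 0)
    (mono : ∀ n f, P (mono q n f)) (add : ∀ a b, P a → P b → P (a + b)) : P a :=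
  SkewMonoidAlgebra.induction_on a zero (fun n f => mono n.toAdd f) (fun a b => add a b)

theorem cf_mono_mul (m n : ℤ) (f : ℂ[X]) (a : SkewLaurent q) :
    cf q n (mono q m f * a) = f * scaleX q m (cf q (n - m) a) := by
  induction a using SkewLaurent.induction with
  | zero => simp
  | add a b ha hb => simp only [mul_add, map_add, ha, hb]
  | mono k g =>
    rw [mono_mul_mono, cf_mono, cf_mono]
    by_cases h : k = n - m
    · rw [if_pos h, if_pos (by omega)]
    · rw [if_neg h, if_neg (by omega), map_zero, mul_zero]

theorem cf_mul_mono (m n : ℤ) (f : ℂ[X]) (a : SkewLaurent q) :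
    cf q n (a * mono q m f) = cf q (n - m) a * scaleX q (n - m) f := by
  induction a using SkewLaurent.induction with
  | zero => simp
  | add a b ha hb => simp only [add_mul, map_add, ha, hb]
  | mono k g =>
    rw [mono_mul_mono, cf_mono, cf_mono]
    by_cases h : k = n - m
    · rw [if_pos h, if_pos (by omega), h]
    · rw [if_neg h, if_neg (by omega), zero_mul]

end SkewLaurent
open SkewLaurent

variable (q) in
/-- The polynomial `q² X² + q X` expressing `x₋₁ x₁` through `x₀`. -/
def negPosPoly : ℂ[X] :=
  Polynomial.C ((q : ℂ) ^ 2) * Polynomial.X ^ 2 + Polynomial.C (q : ℂ) * Polynomial.X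

variable (q) in
/-- The images of the generators in the skew Laurent algebra. -/
def genImage : Gen → SkewLaurent q
  | .neg => mono q (-1) (negPosPoly q)
  | .zero => mono q 0 Polynomial.X
  | .pos => mono q 1 1

variable (q) in
/-- The embedding of the Podleś sphere into the skew Laurent algebra. -/
def toSkewLaurent : Podles q →ₐ[ℂ] SkewLaurent q :=
  RingQuot.liftAlgHom ℂ ⟨FreeAlgebra.lift ℂ (genImage q), by
    have hq : (q : ℂ) ≠ 0 := q.ne_zero
    rintro _ _ (_ | _ | _ | _) <;>
    (simp only [map_mul, map_add, map_smul, FreeAlgebra.lift_ι_apply, genImage, pow_two,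
      mono_mul_mono, add_zero, zero_add, add_neg_cancel, neg_add_cancel]
     simp only [← map_smul, ← map_add]
     -- Both sides have the same `y`-degree. Their coefficients are compared as functions on `ℂ`,
     -- where the rescaling of `X` becomes a numerical factor.
     refine congrArg (mono q _) (Polynomial.funext fun r => ?_)
     simp only [negPosPoly, Polynomial.eval_mul, Polynomial.eval_add, Polynomial.eval_smul,
       eval_scaleX, Polynomial.eval_X, Polynomial.eval_pow, Polynomial.eval_C, Polynomial.eval_one,
       smul_eq_mul]
     simp
     try field_simp
     try ring_nf
     try simp)⟩

@[simp] theorem toSkewLaurent_x (i : Gen) : toSkewLaurent q (x q i) = genImage q i := by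
  refine (RingQuot.liftAlgHom_mkAlgHom_apply ℂ _ _ _).trans ?_
  simp

/-- Elements of the Podleś sphere are built from the generators by left multiplication. -/
theorem mul_mem_of_x_mul_mem (S : Submodule ℂ (Podles q))
    (h : ∀ i, ∀ s ∈ S, x q i * s ∈ S) (a : Podles q) : ∀ s ∈ S, a * s ∈ S := by
  obtain ⟨a, rfl⟩ := mk_surjective a
  induction a using FreeAlgebra.induction with
  | grade0 r =>
    intro s hs
    rw [AlgHom.commutes, ← Algebra.smul_def]
    exact S.smul_mem r hs
  | grade1 i => exact h i
  | mul a b ha hb =>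
    intro s hs
    rw [map_mul, mul_assoc]
    exact ha _ (hb s hs)
  | add a b ha hb =>
    intro s hs
    rw [map_add, add_mul]
    exact S.add_mem (ha s hs) (hb s hs)

variable (q) in
/-- The element `x₁ʲ` for `j ≥ 0` and `x₋₁^|j|` for `j < 0`. -/
def xpow : ℤ → Podles q
  | .ofNat n => x q .pos ^ n
  | .negSucc n => x q .neg ^ (n + 1)

theorem xpow_natCast (n : ℕ) : xpow q n = x q .pos ^ n := rfl

theorem xpow_zero : xpow q 0 = 1 := pow_zero (x q .pos)

theorem xpow_neg_natCast (n : ℕ) : xpow q (-n) = x q .neg ^ n := by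
  cases n with
  | zero => exact (pow_zero (x q .pos)).trans (pow_zero (x q .neg)).symm
  | succ n => rfl

variable (q) in
/-- The Poincaré–Birkhoff–Witt monomial `x₀ⁱ x₁ʲ` or `x₀ⁱ x₋₁^|j|`. -/
def pbw (p : ℤ × ℕ) : Podles q := x q .zero ^ p.2 * xpow q p.1

theorem x_pos_zero_pow (i : ℕ) : x q .pos * x q .zero ^ i =
    ((q : ℂ)⁻¹ ^ 2) ^ i • (x q .zero ^ i * x q .pos) := by
  induction i with
  | zero => simp
  | succ i ih =>
    rw [pow_succ (x q .zero), ← mul_assoc, ih, smul_mul_assoc, mul_assoc, x_pos_zero,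
      mul_smul_comm, smul_smul, ← mul_assoc, ← pow_succ]

theorem x_neg_zero_pow (i : ℕ) : x q .neg * x q .zero ^ i =
    ((q : ℂ) ^ 2) ^ i • (x q .zero ^ i * x q .neg) := by
  induction i with
  | zero => simp
  | succ i ih =>
    rw [pow_succ (x q .zero), ← mul_assoc, ih, smul_mul_assoc, mul_assoc, x_neg_zero,
      mul_smul_comm, smul_smul, ← mul_assoc, ← pow_succ]

theorem zero_mul_pbw (j : ℤ) (i : ℕ) : x q .zero * pbw q (j, i) = pbw q (j, i + 1) := by
  rw [pbw, pbw, ← mul_assoc, ← pow_succ']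

theorem span_pbw : Submodule.span ℂ (Set.range (pbw q)) = ⊤ := by
  set S := Submodule.span ℂ (Set.range (pbw q)) with hS
  have hb : ∀ j i, pbw q (j, i) ∈ S := fun j i => Submodule.subset_span ⟨_, rfl⟩
  -- A generator `x₁` or `x₋₁` is first moved past `x₀ⁱ`. It then either lengthens the power behind
  -- it or cancels one opposite factor through the quadratic relation.
  have hgen : ∀ g, ∀ s ∈ S, x q g * s ∈ S := by
    intro g s hs
    induction hs using Submodule.span_induction with
    | zero => rw [mul_zero]; exact S.zero_mem
    | add s t _ _ hs ht => rw [mul_add]; exact S.add_mem hs ht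
    | smul c s _ hs => rw [mul_smul_comm]; exact S.smul_mem c hs
    | mem s hs =>
      obtain ⟨⟨j, i⟩, rfl⟩ := hs
      cases g with
      | zero => rw [zero_mul_pbw]; exact hb _ _
      | pos =>
        rw [pbw, ← mul_assoc, x_pos_zero_pow, smul_mul_assoc]
        refine S.smul_mem _ ?_
        rw [mul_assoc]
        rcases j with n | n
        · have : x q .pos * xpow q (Int.ofNat n) = xpow q (n + 1 : ℕ) :=
            (pow_succ' (x q .pos) n).symm
          rw [this]
          exact hb (n + 1 : ℕ) i
        · have : xpow q (Int.negSucc n) = x q .neg * xpow q (-n) := by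
            rw [xpow_neg_natCast]; exact pow_succ' _ _
          rw [this, ← mul_assoc (x q .pos), x_pos_neg, add_mul, mul_add, smul_mul_assoc,
            smul_mul_assoc, mul_smul_comm, mul_smul_comm, ← mul_assoc, ← mul_assoc, ← pow_add,
            ← pow_succ]
          exact S.add_mem (S.smul_mem _ (hb _ _)) (S.smul_mem _ (hb _ _))
      | neg =>
        rw [pbw, ← mul_assoc, x_neg_zero_pow, smul_mul_assoc]
        refine S.smul_mem _ ?_
        rw [mul_assoc]
        obtain ⟨n, rfl | rfl⟩ := j.eq_nat_or_neg
        · cases n with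
          | zero =>
            have : x q .neg * xpow q (0 : ℕ) = xpow q (-(1 : ℕ)) := by
              rw [xpow_neg_natCast, pow_one, Nat.cast_zero, xpow_zero, mul_one]
            rw [this]
            exact hb (-(1 : ℕ)) i
          | succ n =>
            rw [xpow_natCast, pow_succ', ← mul_assoc (x q .neg), x_neg_pos, add_mul, mul_add,
              smul_mul_assoc, smul_mul_assoc, mul_smul_comm, mul_smul_comm, ← mul_assoc,
              ← mul_assoc, ← pow_add, ← pow_succ, ← xpow_natCast]
            exact S.add_mem (S.smul_mem _ (hb _ _)) (S.smul_mem _ (hb _ _))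
        · have : x q .neg * xpow q (-n) = xpow q (-(n + 1 : ℕ)) := by
            rw [xpow_neg_natCast, xpow_neg_natCast, pow_succ']
          rw [this]
          exact hb (-(n + 1 : ℕ)) i
  rw [eq_top_iff]
  intro a _
  have h1 : (1 : Podles q) ∈ S := by simpa [pbw, xpow_zero] using hb 0 0
  simpa using mul_mem_of_x_mul_mem S hgen a 1 h1

theorem toSkewLaurent_zero_pow (n : ℕ) :
    toSkewLaurent q (x q .zero ^ n) = mono q 0 (Polynomial.X ^ n) := by
  induction n with
  | zero => simp [one_eq]
  | succ n ih =>
    rw [pow_succ, map_mul, ih, toSkewLaurent_x, genImage, mono_mul_mono, scaleX_zero, add_zero,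
      ← pow_succ]

theorem negPosPoly_ne_zero : negPosPoly q ≠ 0 := by
  intro h
  have := congrArg (Polynomial.coeff · 1) h
  simp only [negPosPoly, Polynomial.coeff_add, Polynomial.coeff_C_mul,
      Polynomial.coeff_X_pow,
    Polynomial.coeff_X_one, Polynomial.coeff_zero] at this
  simp at this

/-- Each factor `x₋₁` contributes a rescaled copy of `negPosPoly`, and `ℂ[X]` is a domain. Only
nonvanishing of `P` matters for linear independence. -/
theorem exists_toSkewLaurent_xpow (j : ℤ) :
    ∃ P : ℂ[X], P ≠ 0 ∧ toSkewLaurent q (xpow q j) = mono q j P := by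
  obtain ⟨n, rfl | rfl⟩ := j.eq_nat_or_neg
  · refine ⟨1, one_ne_zero, ?_⟩
    rw [xpow_natCast]
    induction n with
    | zero => simp [one_eq]
    | succ n ih =>
      rw [pow_succ, map_mul, ih, toSkewLaurent_x, genImage, mono_mul_mono, map_one, mul_one,
        Nat.cast_succ]
  · rw [xpow_neg_natCast]
    induction n with
    | zero => exact ⟨1, one_ne_zero, by simp [one_eq]⟩
    | succ n ih =>
      obtain ⟨P, hP, h⟩ := ih
      refine ⟨P * scaleX q (-n) (negPosPoly q),
        mul_ne_zero hP (scaleX_ne_zero _ negPosPoly_ne_zero), ?_⟩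
      rw [pow_succ, map_mul, h, toSkewLaurent_x, genImage, mono_mul_mono, Nat.cast_succ, neg_add]

variable (q) in
/-- The polynomial `P` with `x₁ʲ ↦ P(X) yʲ` (or `x₋₁^|j| ↦ P(X) yʲ`). -/
def xpowPoly (j : ℤ) : ℂ[X] := (exists_toSkewLaurent_xpow (q := q) j).choose

theorem xpowPoly_ne_zero (j : ℤ) : xpowPoly q j ≠ 0 :=
  (exists_toSkewLaurent_xpow (q := q) j).choose_spec.1

theorem toSkewLaurent_xpow (j : ℤ) : toSkewLaurent q (xpow q j) = mono q j (xpowPoly q j) :=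
  (exists_toSkewLaurent_xpow (q := q) j).choose_spec.2

theorem toSkewLaurent_pbw (p : ℤ × ℕ) :
    toSkewLaurent q (pbw q p) = mono q p.1 (Polynomial.X ^ p.2 * xpowPoly q p.1) := by
  rw [pbw, map_mul, toSkewLaurent_zero_pow, toSkewLaurent_xpow, mono_mul_mono, scaleX_zero,
    zero_add]

theorem linearIndependent_toSkewLaurent_pbw :
    LinearIndependent ℂ fun p : ℤ × ℕ => toSkewLaurent q (pbw q p) := by
  classical
  rw [linearIndependent_iff']
  rintro s g hg ⟨j, i⟩ hp
  have h := congrArg (cf q j) hg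
  simp only [map_sum, map_smul, toSkewLaurent_pbw, cf_mono, map_zero] at h
  -- In a fixed `y`-degree all monomials share the factor `xpowPoly q j`. Cancelling it leaves
  -- distinct powers of `X`.
  have h2 : (∑ p ∈ s, if p.1 = j then g p • (Polynomial.X : ℂ[X]) ^ p.2 else 0) *
      xpowPoly q j = 0 := by
    rw [Finset.sum_mul]
    refine (Finset.sum_congr rfl fun p _ => ?_).trans h
    split_ifs with hj
    · rw [hj, smul_mul_assoc]
    · rw [zero_mul, smul_zero]
  have h3 := congrArg (Polynomial.coeff · i) ((mul_eq_zero.1 h2).resolve_right (xpowPoly_ne_zero j))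
  simp only [Polynomial.finsetSum_coeff, Polynomial.coeff_zero] at h3
  rw [← h3, Finset.sum_eq_single_of_mem (j, i) hp]
  · simp
  · rintro ⟨j', i'⟩ _ hne
    by_cases hj : j' = j
    · subst hj
      have : i ≠ i' := fun h => hne (by rw [h])
      simp [Polynomial.coeff_X_pow, this]
    · simp [hj]

variable (q) in
/-- The Poincaré–Birkhoff–Witt basis of the Podleś sphere. -/
def pbwBasis : Module.Basis (ℤ × ℕ) ℂ (Podles q) :=
  .mk (v := pbw q)
    (LinearIndependent.of_comp (toSkewLaurent q).toLinearMap linearIndependent_toSkewLaurent_pbw)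
    span_pbw.ge

theorem pbwBasis_apply (p : ℤ × ℕ) : pbwBasis q p = pbw q p := Module.Basis.mk_apply _ _ _

theorem toSkewLaurent_injective : Function.Injective (toSkewLaurent q) := by
  refine (injective_iff_map_eq_zero (toSkewLaurent q)).2 fun a ha => ?_
  have h : (pbwBasis q).repr a = 0 := by
    refine linearIndependent_iff.1 (linearIndependent_toSkewLaurent_pbw (q := q)) _ ?_
    rw [← ha]
    conv_rhs => rw [← (pbwBasis q).linearCombination_repr a]
    rw [← AlgHom.toLinearMap_apply, Finsupp.apply_linearCombination]
    congr 2
    funext p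
    simp [pbwBasis_apply]
  simpa using h

end Podles

/-! ### Reduction of 2-chains modulo boundaries. -/

namespace TwistedHochschild
section General
variable {k A : Type*} [CommRing k] [Ring A] [Algebra k A]

theorem boundary_boundary (σ : A ≃ₐ[k] A) (z : Chain k A 3) :
    boundary σ 1 (boundary σ 2 z) = 0 := by
  have h : boundary σ 1 ∘ₗ boundary σ 2 = 0 := by
    ext a
    have ha : a = ![a 0, a 1, a 2, a 3] := by funext i; fin_cases i <;> rfl
    rw [LinearMap.compMultilinearMap_apply, LinearMap.comp_apply, ha, boundary_tensor₄]
    simp only [map_add, map_sub, boundary_tensor₃, map_mul, mul_assoc]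
    simp only [LinearMap.zero_compMultilinearMap, zero_apply]
    abel
  exact LinearMap.congr_fun h z

theorem tensor₃_relation_mem (σ : A ≃ₐ[k] A) {S : Submodule k (Chain k A 2)}
    (hS : boundaries σ 2 ≤ S) (a b c d : A) :
    tensor₃ k (a * b) c d - tensor₃ k a (b * c) d + tensor₃ k a b (c * d)
      - tensor₃ k (σ d * a) b c ∈ S := by
  rw [← boundary_tensor₄]
  exact hS ⟨_, rfl⟩

theorem tensor₃_mul_middle_mem (σ : A ≃ₐ[k] A) {S : Submodule k (Chain k A 2)}
    (hS : boundaries σ 2 ≤ S) {a b c d : A} (h₁ : tensor₃ k (a * b) c d ∈ S)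
    (h₂ : tensor₃ k a b (c * d) ∈ S) (h₃ : tensor₃ k (σ d * a) b c ∈ S) :
    tensor₃ k a (b * c) d ∈ S := by
  have := S.sub_mem (S.sub_mem (S.add_mem h₁ h₂) h₃) (tensor₃_relation_mem σ hS a b c d)
  convert this using 1
  abel

theorem tensor₃_mul_right_mem (σ : A ≃ₐ[k] A) {S : Submodule k (Chain k A 2)}
    (hS : boundaries σ 2 ≤ S) {a b c d : A} (h₁ : tensor₃ k (a * b) c d ∈ S)
    (h₂ : tensor₃ k a (b * c) d ∈ S) (h₃ : tensor₃ k (σ d * a) b c ∈ S) :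
    tensor₃ k a b (c * d) ∈ S := by
  have := S.add_mem (S.add_mem (S.sub_mem h₂ h₁) h₃) (tensor₃_relation_mem σ hS a b c d)
  convert this using 1
  abel

theorem tensor₃_add_middle (a b b' c : A) :
    tensor₃ k a (b + b') c = tensor₃ k a b c + tensor₃ k a b' c := by
  simp only [← tensor₃Lin_apply, map_add, LinearMap.add_apply]

theorem tensor₃_smul_middle (r : k) (a b c : A) :
    tensor₃ k a (r • b) c = r • tensor₃ k a b c := by
  simp only [← tensor₃Lin_apply, map_smul, LinearMap.smul_apply]

theorem tensor₃_one_middle_mem (σ : A ≃ₐ[k] A) {S : Submodule k (Chain k A 2)}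
    (hS : boundaries σ 2 ≤ S) (h1 : ∀ m, tensor₃ k m 1 1 ∈ S) (m b : A) :
    tensor₃ k m 1 b ∈ S := by
  have := S.add_mem (tensor₃_relation_mem σ hS m 1 1 b) (h1 (σ b * m))
  simpa using this

theorem tensor₃_one_right_mem (σ : A ≃ₐ[k] A) {S : Submodule k (Chain k A 2)}
    (hS : boundaries σ 2 ≤ S) (h1 : ∀ m, tensor₃ k m 1 1 ∈ S) (m b : A) :
    tensor₃ k m b 1 ∈ S := by
  have := S.sub_mem (h1 (m * b)) (tensor₃_relation_mem σ hS m b 1 1)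
  simpa using this

/-- Moving powers of `h` out of the last tensor factor modulo boundaries. -/
theorem tensor₃_mem_of_skew (σ : A ≃ₐ[k] A) {S : Submodule k (Chain k A 2)}
    (hS : boundaries σ 2 ≤ S) {h x : A} {c : k} (hx : x * h = c • (h * x))
    (Hh : ∀ m b, tensor₃ k m h b ∈ S) (Hxh : ∀ m, tensor₃ k m x h ∈ S) (w : A)
    (Hw : ∀ m, tensor₃ k m x w ∈ S) (i : ℕ) : ∀ m, tensor₃ k m x (h ^ i * w) ∈ S := by
  induction i with
  | zero => simpa using Hw
  | succ i ih =>
    intro m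
    rw [pow_succ', mul_assoc]
    refine tensor₃_mul_right_mem σ hS (Hh _ _) ?_ (Hxh _)
    rw [hx, tensor₃_smul_middle]
    exact S.smul_mem _ (tensor₃_mul_middle_mem σ hS (ih _) (Hh _ _) (Hh _ _))

/-- The boundary of `m ⊗ x ⊗ y ⊗ yⁿ` trades the term for `mx ⊗ y ⊗ yⁿ`, a chain ending in `x ⊗ y`,
and `m ⊗ xy ⊗ yⁿ`. In the last, `xy` is a polynomial in `h` and can be split into chains with middle
factor `h`. -/
theorem tensor₃_mem_of_mul_eq (σ : A ≃ₐ[k] A) {S : Submodule k (Chain k A 2)}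
    (hS : boundaries σ 2 ≤ S) {h x y : A} {c d : k} (hxy : x * y = c • h ^ 2 + d • h)
    (Hh : ∀ m b, tensor₃ k m h b ∈ S) (Hxy : ∀ m, tensor₃ k m x y ∈ S) (n : ℕ)
    (Hy : ∀ m, tensor₃ k m y (y ^ n) ∈ S) (m : A) : tensor₃ k m x (y ^ (n + 1)) ∈ S := by
  rw [pow_succ']
  refine tensor₃_mul_right_mem σ hS (Hy _) ?_ (Hxy _)
  rw [hxy, tensor₃_add_middle, tensor₃_smul_middle, tensor₃_smul_middle, pow_two]
  exact S.add_mem (S.smul_mem _ (tensor₃_mul_middle_mem σ hS (Hh _ _) (Hh _ _) (Hh _ _)))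
    (S.smul_mem _ (Hh _ _))

end General
end TwistedHochschild

/-! ### A partial contraction and the reduction of cycles to the defining relations. -/

namespace Podles
open TwistedHochschild
variable {q : ℂˣ}

variable (q) in
/-- The chain given by coefficients `(u₊, u₋, v₊, v₋)` at the defining relations of `x₁ x₀`,
`x₋₁ x₀`, `x₁ x₋₁` and `x₋₁ x₁`. -/
def relChain : Podles q × Podles q × Podles q × Podles q →ₗ[ℂ] Chain ℂ (Podles q) 2 :=
  let t := tensor₃Lin ℂ (Podles q)
  { toFun := fun v =>
      t v.1 (x q .pos) (x q .zero) - (q : ℂ)⁻¹ ^ 2 • t v.1 (x q .zero) (x q .pos)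
      + (t v.2.1 (x q .neg) (x q .zero) - (q : ℂ) ^ 2 • t v.2.1 (x q .zero) (x q .neg))
      + (t v.2.2.1 (x q .pos) (x q .neg) - (q : ℂ)⁻¹ ^ 2 • t v.2.2.1 (x q .zero) (x q .zero))
      + (t v.2.2.2 (x q .neg) (x q .pos) - (q : ℂ) ^ 2 • t v.2.2.2 (x q .zero) (x q .zero))
    map_add' := fun v w => by
      simp only [Prod.fst_add, Prod.snd_add, map_add, LinearMap.add_apply]
      module
    map_smul' := fun c v => by
      simp only [Prod.smul_fst, Prod.smul_snd, map_smul, LinearMap.smul_apply, RingHom.id_apply]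
      module }

theorem relChain_apply (u₁ u₂ v₁ v₂ : Podles q) : relChain q (u₁, u₂, v₁, v₂) =
    tensor₃ ℂ u₁ (x q .pos) (x q .zero) - (q : ℂ)⁻¹ ^ 2 • tensor₃ ℂ u₁ (x q .zero) (x q .pos)
    + (tensor₃ ℂ u₂ (x q .neg) (x q .zero) - (q : ℂ) ^ 2 • tensor₃ ℂ u₂ (x q .zero) (x q .neg))
    + (tensor₃ ℂ v₁ (x q .pos) (x q .neg) - (q : ℂ)⁻¹ ^ 2 • tensor₃ ℂ v₁ (x q .zero) (x q .zero))
    + (tensor₃ ℂ v₂ (x q .neg) (x q .pos) - (q : ℂ) ^ 2 • tensor₃ ℂ v₂ (x q .zero) (x q .zero)) :=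
  rfl

/-- The coefficient at `x₁` of the boundary of `relChain`. -/
def relPos (σ : Podles q ≃ₐ[ℂ] Podles q) (u₁ v₁ v₂ : Podles q) : Podles q :=
  σ (x q .zero) * u₁ - (q : ℂ)⁻¹ ^ 2 • (u₁ * x q .zero) + σ (x q .neg) * v₁ + v₂ * x q .neg

/-- The coefficient at `x₋₁` of the boundary of `relChain`. -/
def relNeg (σ : Podles q ≃ₐ[ℂ] Podles q) (u₂ v₁ v₂ : Podles q) : Podles q :=
  σ (x q .zero) * u₂ - (q : ℂ) ^ 2 • (u₂ * x q .zero) + σ (x q .pos) * v₂ + v₁ * x q .pos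

/-- The coefficient at `x₀` of the boundary of `relChain`. -/
def relZero (σ : Podles q ≃ₐ[ℂ] Podles q) (u₁ u₂ v₁ v₂ : Podles q) : Podles q :=
  u₁ * x q .pos - (q : ℂ)⁻¹ ^ 2 • (σ (x q .pos) * u₁)
    + (u₂ * x q .neg - (q : ℂ) ^ 2 • (σ (x q .neg) * u₂))
    - (q : ℂ)⁻¹ ^ 2 • (v₁ * x q .zero + σ (x q .zero) * v₁) - (q : ℂ)⁻¹ • v₁
    - (q : ℂ) ^ 2 • (v₂ * x q .zero + σ (x q .zero) * v₂) - (q : ℂ) • v₂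

theorem boundary_relChain (σ : Podles q ≃ₐ[ℂ] Podles q) (u₁ u₂ v₁ v₂ : Podles q) :
    boundary σ 1 (relChain q (u₁, u₂, v₁, v₂)) =
      tensor₂ ℂ (Podles q) (relPos σ u₁ v₁ v₂) (x q .pos)
      + tensor₂ ℂ (Podles q) (relNeg σ u₂ v₁ v₂) (x q .neg)
      + tensor₂ ℂ (Podles q) (relZero σ u₁ u₂ v₁ v₂) (x q .zero) := by
  simp only [relChain_apply, relPos, relNeg, relZero, map_add, map_sub, map_smul,
    boundary_tensor₃, x_pos_zero, x_neg_zero, x_pos_neg, x_neg_pos, LinearMap.add_apply,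
    LinearMap.sub_apply, LinearMap.smul_apply, ← pow_two]
  module

variable (q) in
/-- The recursion for the contraction on `m ⊗ zⁿ`, `z` a generator. -/
def contractPow (z : Podles q) : ℕ → (Podles q →ₗ[ℂ] Chain ℂ (Podles q) 2)
  | 0 => ((tensor₃Lin ℂ (Podles q)).flip 1).flip 1
  | 1 => 0
  | n + 2 => contractPow z (n + 1) ∘ₗ LinearMap.mulRight ℂ z
      - ((tensor₃Lin ℂ (Podles q)).flip z).flip (z ^ (n + 1))

variable (q) in
/-- The value of the contraction on `m ⊗ pbw (j, i)`. -/
def contractPBW (j : ℤ) : ℕ → (Podles q →ₗ[ℂ] Chain ℂ (Podles q) 2)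
  | 0 => match j with
    | .ofNat n => contractPow q (x q .pos) n
    | .negSucc n => contractPow q (x q .neg) (n + 1)
  -- The exceptional case is the basis element `x₀`: the contraction has to vanish on all `m ⊗ xᵢ`,
  -- so that it kills boundaries of relation chains.
  | i + 1 => if j = 0 ∧ i = 0 then 0 else
      contractPBW j i ∘ₗ LinearMap.mulRight ℂ (x q .zero)
      - ((tensor₃Lin ℂ (Podles q)).flip (x q .zero)).flip (pbw q (j, i))

variable (q) in
/-- A partial contraction `C_1 → C_2` of the Hochschild complex. -/
def contract : Chain ℂ (Podles q) 1 →ₗ[ℂ] Chain ℂ (Podles q) 2 :=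
  liftChain₁ ((pbwBasis q).constr ℂ fun p => contractPBW q p.1 p.2).flip

theorem contract_pbw (m : Podles q) (p : ℤ × ℕ) :
    contract q (tensor₂ ℂ _ m (pbw q p)) = contractPBW q p.1 p.2 m := by
  rw [contract, liftChain₁_tensor₂, LinearMap.flip_apply, ← pbwBasis_apply,
    Module.Basis.constr_basis]

theorem pbw_zero_zero : pbw q (0, 0) = 1 := by simp [pbw, xpow_zero]

theorem pbw_pos (n : ℕ) : pbw q (n, 0) = x q .pos ^ n := by simp [pbw, xpow_natCast]

theorem pbw_neg (n : ℕ) : pbw q (-n, 0) = x q .neg ^ n := by simp [pbw, xpow_neg_natCast]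

theorem pbw_zero_one : pbw q (0, 1) = x q .zero := by simp [pbw, xpow_zero]

theorem contract_pos_pow (m : Podles q) (n : ℕ) :
    contract q (tensor₂ ℂ _ m (x q .pos ^ n)) = contractPow q (x q .pos) n m := by
  rw [← pbw_pos, contract_pbw]; rfl

theorem contract_neg_pow (m : Podles q) (n : ℕ) :
    contract q (tensor₂ ℂ _ m (x q .neg ^ n)) = contractPow q (x q .neg) n m := by
  cases n with
  | zero => rw [pow_zero, ← pow_zero (x q .pos), contract_pos_pow]; rfl
  | succ n => rw [← pbw_neg, contract_pbw]; rfl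

theorem contract_x (m : Podles q) (i : Gen) : contract q (tensor₂ ℂ _ m (x q i)) = 0 := by
  cases i with
  | neg => simpa [contractPow] using contract_neg_pow m 1
  | zero => rw [← pbw_zero_one, contract_pbw]; simp [contractPBW]
  | pos => simpa [contractPow] using contract_pos_pow m 1

theorem contract_boundary_one (σ : Podles q ≃ₐ[ℂ] Podles q) (m : Podles q) :
    contract q (boundary σ 1 (tensor₃ ℂ m 1 1)) = tensor₃ ℂ m 1 1 := by
  have h := contract_pos_pow m 0
  rw [pow_zero] at h
  simp [boundary_tensor₃, h, contractPow, tensor₃Lin_apply]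

/-- The product of the last two factors is again a basis element and the cyclic face ends in a
generator, where the contraction is zero. The remaining two faces are exactly those related by the
recursion defining `contractPow`. The versions for `x₋₁` and `x₀` below work the same way. -/
theorem contract_boundary_pos (σ : Podles q ≃ₐ[ℂ] Podles q) (m : Podles q) (n : ℕ) :
    contract q (boundary σ 1 (tensor₃ ℂ m (x q .pos) (x q .pos ^ (n + 1)))) =
      tensor₃ ℂ m (x q .pos) (x q .pos ^ (n + 1)) := by
  rw [boundary_tensor₃, map_add, map_sub, contract_x, ← pow_succ', contract_pos_pow,
    contract_pos_pow]
  simp [contractPow, tensor₃Lin_apply]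

theorem contract_boundary_neg (σ : Podles q ≃ₐ[ℂ] Podles q) (m : Podles q) (n : ℕ) :
    contract q (boundary σ 1 (tensor₃ ℂ m (x q .neg) (x q .neg ^ (n + 1)))) =
      tensor₃ ℂ m (x q .neg) (x q .neg ^ (n + 1)) := by
  rw [boundary_tensor₃, map_add, map_sub, contract_x, ← pow_succ', contract_neg_pow,
    contract_neg_pow]
  simp [contractPow, tensor₃Lin_apply]

theorem contract_boundary_zero (σ : Podles q ≃ₐ[ℂ] Podles q) (m : Podles q) {p : ℤ × ℕ}
    (hp : p ≠ (0, 0)) :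
    contract q (boundary σ 1 (tensor₃ ℂ m (x q .zero) (pbw q p))) =
      tensor₃ ℂ m (x q .zero) (pbw q p) := by
  obtain ⟨j, i⟩ := p
  rw [boundary_tensor₃, map_add, map_sub, contract_x, zero_mul_pbw, contract_pbw, contract_pbw,
    contractPBW, if_neg (fun h => hp (Prod.ext h.1 h.2))]
  simp [tensor₃Lin_apply]

theorem contract_boundary_relChain (σ : Podles q ≃ₐ[ℂ] Podles q)
    (v : Podles q × Podles q × Podles q × Podles q) :
    contract q (boundary σ 1 (relChain q v)) = 0 := by
  obtain ⟨u₁, u₂, v₁, v₂⟩ := v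
  simp [boundary_relChain, contract_x]

/-- Every 2-chain is, modulo boundaries, the sum of a chain fixed by `contract ∘ b` and a chain
supported on the defining relations. -/
theorem chain_decomposition (σ : Podles q ≃ₐ[ℂ] Podles q) :
    LinearMap.eqLocus (contract q ∘ₗ boundary σ 1) LinearMap.id ⊔ LinearMap.range (relChain q)
      ⊔ boundaries σ 2 = ⊤ := by
  set N := LinearMap.eqLocus (contract q ∘ₗ boundary σ 1) LinearMap.id with hN
  set S := N ⊔ LinearMap.range (relChain q) ⊔ boundaries σ 2 with hSdef
  have hS : boundaries σ 2 ≤ S := le_sup_right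
  have hNS : N ≤ S := le_sup_left.trans le_sup_left
  have hR : ∀ v, relChain q v ∈ S := fun v =>
    (le_sup_right.trans le_sup_left : LinearMap.range (relChain q) ≤ S) ⟨v, rfl⟩
  have h11 : ∀ m, tensor₃ ℂ m 1 1 ∈ S := fun m => hNS (contract_boundary_one σ m)
  -- Since `x₀` stands leftmost in basis monomials, `x₀` times such a monomial is again one. Chains
  -- with middle factor `x₀` therefore need no relation.
  have Hz : ∀ m b, tensor₃ ℂ m (x q .zero) b ∈ S := by
    intro m b
    have hb : b ∈ Submodule.span ℂ (Set.range (pbw q)) := by rw [span_pbw]; trivial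
    refine (Submodule.span_le (p := S.comap (tensor₃Lin ℂ _ m (x q .zero)))).2 ?_ hb
    rintro _ ⟨p, rfl⟩
    change tensor₃ ℂ m (x q .zero) (pbw q p) ∈ S
    by_cases hp : p = (0, 0)
    · rw [hp, pbw_zero_zero]; exact tensor₃_one_right_mem σ hS h11 _ _
    · exact hNS (contract_boundary_zero σ m hp)
  have Hpp : ∀ n m, tensor₃ ℂ m (x q .pos) (x q .pos ^ n) ∈ S := by
    rintro (_ | n) m
    · rw [pow_zero]; exact tensor₃_one_right_mem σ hS h11 _ _
    · exact hNS (contract_boundary_pos σ m n)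
  have Hnn : ∀ n m, tensor₃ ℂ m (x q .neg) (x q .neg ^ n) ∈ S := by
    rintro (_ | n) m
    · rw [pow_zero]; exact tensor₃_one_right_mem σ hS h11 _ _
    · exact hNS (contract_boundary_neg σ m n)
  -- The four products that are not in normal form are supplied by the relation chains, up to chains
  -- with middle factor `x₀`.
  have Hpz : ∀ m, tensor₃ ℂ m (x q .pos) (x q .zero) ∈ S := fun m => by
    have := S.add_mem (hR (m, 0, 0, 0)) (S.smul_mem ((q : ℂ)⁻¹ ^ 2) (Hz m (x q .pos)))
    simpa [relChain_apply, ← tensor₃Lin_apply] using this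
  have Hnz : ∀ m, tensor₃ ℂ m (x q .neg) (x q .zero) ∈ S := fun m => by
    have := S.add_mem (hR (0, m, 0, 0)) (S.smul_mem ((q : ℂ) ^ 2) (Hz m (x q .neg)))
    simpa [relChain_apply, ← tensor₃Lin_apply] using this
  have Hpn : ∀ m, tensor₃ ℂ m (x q .pos) (x q .neg) ∈ S := fun m => by
    have := S.add_mem (hR (0, 0, m, 0)) (S.smul_mem ((q : ℂ)⁻¹ ^ 2) (Hz m (x q .zero)))
    simpa [relChain_apply, ← tensor₃Lin_apply] using this
  have Hnp : ∀ m, tensor₃ ℂ m (x q .neg) (x q .pos) ∈ S := fun m => by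
    have := S.add_mem (hR (0, 0, 0, m)) (S.smul_mem ((q : ℂ) ^ 2) (Hz m (x q .zero)))
    simpa [relChain_apply, ← tensor₃Lin_apply] using this
  have Hgen : ∀ g m b, tensor₃ ℂ m (x q g) b ∈ S := by
    intro g m b
    have hb : b ∈ Submodule.span ℂ (Set.range (pbw q)) := by rw [span_pbw]; trivial
    refine (Submodule.span_le (p := S.comap (tensor₃Lin ℂ _ m (x q g)))).2 ?_ hb
    rintro _ ⟨⟨j, i⟩, rfl⟩
    change tensor₃ ℂ m (x q g) (x q .zero ^ i * xpow q j) ∈ S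
    cases g with
    | zero => exact Hz _ _
    | pos =>
      refine tensor₃_mem_of_skew σ hS x_pos_zero Hz Hpz _ (fun m => ?_) i m
      obtain ⟨n, rfl | rfl⟩ := j.eq_nat_or_neg
      · rw [xpow_natCast]; exact Hpp n m
      · rw [xpow_neg_natCast]
        cases n with
        | zero => simpa using Hpp 0 m
        | succ n => exact tensor₃_mem_of_mul_eq σ hS x_pos_neg Hz Hpn n (Hnn n) m
    | neg =>
      refine tensor₃_mem_of_skew σ hS x_neg_zero Hz Hnz _ (fun m => ?_) i m
      obtain ⟨n, rfl | rfl⟩ := j.eq_nat_or_neg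
      · rw [xpow_natCast]
        cases n with
        | zero => simpa using Hnn 0 m
        | succ n => exact tensor₃_mem_of_mul_eq σ hS x_neg_pos Hz Hnp n (Hpp n) m
      · rw [xpow_neg_natCast]; exact Hnn n m
  refine span_tensor₃ S fun m a b => ?_
  obtain ⟨a, rfl⟩ := mk_surjective a
  -- Splitting a product in the middle factor alters both outer factors, so the induction must leave
  -- them free.
  induction a using FreeAlgebra.induction generalizing m b with
  | grade0 r =>
    rw [AlgHom.commutes, Algebra.algebraMap_eq_smul_one, tensor₃_smul_middle]
    exact S.smul_mem _ (tensor₃_one_middle_mem σ hS h11 _ _)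
  | grade1 i => exact Hgen i m b
  | mul a b ha hb =>
    rw [map_mul]
    exact tensor₃_mul_middle_mem σ hS (hb _ _) (ha _ _) (ha _ _)
  | add a b ha hb =>
    rw [map_add, tensor₃_add_middle]
    exact S.add_mem (ha _ _) (hb _ _)

/-- The three generators are distinct members of the basis, so coordinate functionals on the second
factor separate the summands. -/
theorem eq_zero_of_tensor₂_sum_eq_zero {a b c : Podles q}
    (h : tensor₂ ℂ (Podles q) a (x q .pos) + tensor₂ ℂ (Podles q) b (x q .neg)
      + tensor₂ ℂ (Podles q) c (x q .zero) = 0) : a = 0 ∧ b = 0 ∧ c = 0 := by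
  have key : ∀ p : ℤ × ℕ, (pbwBasis q).repr (x q .pos) p • a
      + (pbwBasis q).repr (x q .neg) p • b + (pbwBasis q).repr (x q .zero) p • c = 0 := by
    intro p
    have := congrArg (liftChain₁ ((LinearMap.lsmul ℂ (Podles q)).flip.compl₂
      ((pbwBasis q).coord p))) h
    simpa only [map_add, liftChain₁_tensor₂, map_zero, LinearMap.compl₂_apply,
      LinearMap.flip_apply, LinearMap.lsmul_apply, Module.Basis.coord_apply] using this
  have hp : x q .pos = pbwBasis q (1, 0) := by
    rw [pbwBasis_apply]; simpa using (pbw_pos (q := q) 1).symm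
  have hn : x q .neg = pbwBasis q (-1, 0) := by
    rw [pbwBasis_apply]; simpa using (pbw_neg (q := q) 1).symm
  have hz : x q .zero = pbwBasis q (0, 1) := by rw [pbwBasis_apply, pbw_zero_one]
  simp only [hp, hn, hz, Module.Basis.repr_self] at key
  refine ⟨?_, ?_, ?_⟩
  · simpa using key (1, 0)
  · simpa using key (-1, 0)
  · simpa using key (0, 1)

/-- Every 2-cycle is homologous to a cycle supported on the defining relations. -/
theorem exists_relChain_of_cycle (σ : Podles q ≃ₐ[ℂ] Podles q) {ω : Chain ℂ (Podles q) 2}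
    (hω : boundary σ 1 ω = 0) : ∃ u₁ u₂ v₁ v₂ : Podles q,
      relPos σ u₁ v₁ v₂ = 0 ∧ relNeg σ u₂ v₁ v₂ = 0 ∧ relZero σ u₁ u₂ v₁ v₂ = 0 ∧
      ω - relChain q (u₁, u₂, v₁, v₂) ∈ boundaries σ 2 := by
  have hmem : ω ∈ LinearMap.eqLocus (contract q ∘ₗ boundary σ 1) LinearMap.id
      ⊔ LinearMap.range (relChain q) ⊔ boundaries σ 2 := by
    rw [chain_decomposition]; trivial
  obtain ⟨y, hy, β, hβ, rfl⟩ := Submodule.mem_sup.1 hmem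
  obtain ⟨η, hη, _, ⟨⟨u₁, u₂, v₁, v₂⟩, rfl⟩, rfl⟩ := Submodule.mem_sup.1 hy
  have hβ0 : boundary σ 1 β = 0 := by
    obtain ⟨γ, rfl⟩ := hβ
    exact boundary_boundary σ γ
  -- Contracting the boundary of the cycle fixes the component `η` and annihilates the other two, so
  -- `η = 0`.
  have h0 := congrArg (contract q) hω
  rw [map_add, map_add, hβ0, map_add, map_add, contract_boundary_relChain, map_zero, add_zero,
    add_zero] at h0
  have hη0 : η = 0 := (show contract q (boundary σ 1 η) = η from hη).symm.trans h0
  subst hη0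
  rw [map_add, map_add, hβ0, map_zero, zero_add, add_zero, boundary_relChain] at hω
  obtain ⟨h₁, h₂, h₃⟩ := eq_zero_of_tensor₂_sum_eq_zero hω
  exact ⟨u₁, u₂, v₁, v₂, h₁, h₂, h₃, by simpa using hβ⟩

end Podles

/-! ### Syzygies between the relations, and cycles as cap products with `dA`. -/

namespace Podles
open TwistedHochschild
variable {q : ℂˣ}

theorem mkQ_relChain (σ : Podles q ≃ₐ[ℂ] Podles q) (u₁ u₂ v₁ v₂ : Podles q) :
    (boundaries σ 2).mkQ (relChain q (u₁, u₂, v₁, v₂)) =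
      tensorClass σ u₁ (x q .pos) (x q .zero)
      - (q : ℂ)⁻¹ ^ 2 • tensorClass σ u₁ (x q .zero) (x q .pos)
      + (tensorClass σ u₂ (x q .neg) (x q .zero)
        - (q : ℂ) ^ 2 • tensorClass σ u₂ (x q .zero) (x q .neg))
      + (tensorClass σ v₁ (x q .pos) (x q .neg)
        - (q : ℂ)⁻¹ ^ 2 • tensorClass σ v₁ (x q .zero) (x q .zero))
      + (tensorClass σ v₂ (x q .neg) (x q .pos)
        - (q : ℂ) ^ 2 • tensorClass σ v₂ (x q .zero) (x q .zero)) := rfl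

/-- The overlap `x₁x₋₁x₁`: reducing either pair of neighbours first gives the same element. The
boundary of `m ⊗ x₁ ⊗ x₋₁ ⊗ x₁` expresses this at chain level. Three further boundaries break up the
terms containing `x₀²` and bring the result into the form of a relation chain. The next three lemmas
treat the overlaps `x₋₁x₁x₋₁`, `x₁x₋₁x₀` and `x₋₁x₁x₀`. -/
theorem relChain_syzygy_pos_neg_pos (σ : Podles q ≃ₐ[ℂ] Podles q) (m : Podles q) :
    relChain q (m * x q .zero + (q : ℂ) ^ 2 • (σ (x q .zero) * m) + (q : ℂ) • m, 0,
      -(σ (x q .pos) * m), m * x q .pos) ∈ boundaries σ 2 := by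
  have hq : (q : ℂ) ≠ 0 := q.ne_zero
  rw [← Submodule.Quotient.mk_eq_zero, ← Submodule.mkQ_apply, mkQ_relChain]
  have e₁ := tensorClass_mul σ m (x q .pos) (x q .neg) (x q .pos)
  have e₂ := tensorClass_mul σ m (x q .zero) (x q .zero) (x q .pos)
  have e₃ := tensorClass_mul σ m (x q .pos) (x q .zero) (x q .zero)
  have e₄ := tensorClass_mul σ m (x q .zero) (x q .pos) (x q .zero)
  simp only [x_pos_zero, x_pos_neg, x_neg_pos, pow_two (x q .zero), map_add, map_smul,
    LinearMap.add_apply, LinearMap.smul_apply] at e₁ e₂ e₃ e₄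
  simp only [map_add, map_smul, map_neg, map_zero, LinearMap.add_apply, LinearMap.smul_apply,
    LinearMap.neg_apply, LinearMap.zero_apply]
  linear_combination (norm := skip) -e₁ + (q : ℂ)⁻¹ ^ 2 • e₂ + (q : ℂ) ^ 2 • e₃ - e₄
  match_scalars <;> field_simp <;> ring

theorem relChain_syzygy_neg_pos_neg (σ : Podles q ≃ₐ[ℂ] Podles q) (m : Podles q) :
    relChain q (0, m * x q .zero + (q : ℂ)⁻¹ ^ 2 • (σ (x q .zero) * m) + (q : ℂ)⁻¹ • m,
      m * x q .neg, -(σ (x q .neg) * m)) ∈ boundaries σ 2 := by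
  have hq : (q : ℂ) ≠ 0 := q.ne_zero
  rw [← Submodule.Quotient.mk_eq_zero, ← Submodule.mkQ_apply, mkQ_relChain]
  have e₁ := tensorClass_mul σ m (x q .neg) (x q .pos) (x q .neg)
  have e₂ := tensorClass_mul σ m (x q .zero) (x q .zero) (x q .neg)
  have e₃ := tensorClass_mul σ m (x q .neg) (x q .zero) (x q .zero)
  have e₄ := tensorClass_mul σ m (x q .zero) (x q .neg) (x q .zero)
  simp only [x_neg_zero, x_pos_neg, x_neg_pos, pow_two (x q .zero), map_add, map_smul,
    LinearMap.add_apply, LinearMap.smul_apply] at e₁ e₂ e₃ e₄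
  simp only [map_add, map_smul, map_neg, map_zero, LinearMap.add_apply, LinearMap.smul_apply,
    LinearMap.neg_apply, LinearMap.zero_apply]
  linear_combination (norm := skip) -e₁ + (q : ℂ) ^ 2 • e₂ + (q : ℂ)⁻¹ ^ 2 • e₃ - e₄
  match_scalars <;> field_simp <;> ring

theorem relChain_syzygy_pos_neg_zero (σ : Podles q ≃ₐ[ℂ] Podles q) (m : Podles q) :
    relChain q ((q : ℂ) ^ 2 • (σ (x q .neg) * m), m * x q .pos,
      m * x q .zero - σ (x q .zero) * m, 0) ∈ boundaries σ 2 := by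
  have hq : (q : ℂ) ≠ 0 := q.ne_zero
  rw [← Submodule.Quotient.mk_eq_zero, ← Submodule.mkQ_apply, mkQ_relChain]
  have e₁ := tensorClass_mul σ m (x q .pos) (x q .neg) (x q .zero)
  have e₂ := tensorClass_mul σ m (x q .pos) (x q .zero) (x q .neg)
  have e₃ := tensorClass_mul σ m (x q .zero) (x q .pos) (x q .neg)
  have e₄ := tensorClass_mul σ m (x q .zero) (x q .zero) (x q .zero)
  simp only [x_pos_zero, x_neg_zero, x_pos_neg, pow_two (x q .zero), map_add, map_smul,
    LinearMap.add_apply, LinearMap.smul_apply] at e₁ e₂ e₃ e₄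
  simp only [map_sub, map_smul, map_zero, LinearMap.smul_apply, LinearMap.sub_apply,
    LinearMap.zero_apply]
  linear_combination (norm := skip) -e₁ + (q : ℂ) ^ 2 • e₂ - e₃ + (q : ℂ)⁻¹ ^ 2 • e₄
  match_scalars <;> field_simp <;> ring

theorem relChain_syzygy_neg_pos_zero (σ : Podles q ≃ₐ[ℂ] Podles q) (m : Podles q) :
    relChain q (m * x q .neg, (q : ℂ)⁻¹ ^ 2 • (σ (x q .pos) * m), 0,
      m * x q .zero - σ (x q .zero) * m) ∈ boundaries σ 2 := by
  have hq : (q : ℂ) ≠ 0 := q.ne_zero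
  rw [← Submodule.Quotient.mk_eq_zero, ← Submodule.mkQ_apply, mkQ_relChain]
  have e₁ := tensorClass_mul σ m (x q .neg) (x q .pos) (x q .zero)
  have e₂ := tensorClass_mul σ m (x q .neg) (x q .zero) (x q .pos)
  have e₃ := tensorClass_mul σ m (x q .zero) (x q .neg) (x q .pos)
  have e₄ := tensorClass_mul σ m (x q .zero) (x q .zero) (x q .zero)
  simp only [x_pos_zero, x_neg_zero, x_neg_pos, pow_two (x q .zero), map_add, map_smul,
    LinearMap.add_apply, LinearMap.smul_apply] at e₁ e₂ e₃ e₄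
  simp only [map_sub, map_smul, map_zero, LinearMap.smul_apply, LinearMap.sub_apply,
    LinearMap.zero_apply]
  linear_combination (norm := skip) -e₁ + (q : ℂ)⁻¹ ^ 2 • e₂ - e₃ + (q : ℂ) ^ 2 • e₄
  match_scalars <;> field_simp <;> ring

/-- The pairing of a relation chain with the bivector dual to the fundamental class. -/
def dualPairing (σ : Podles q ≃ₐ[ℂ] Podles q) (u₁ u₂ v₁ : Podles q) : Podles q :=
  (q : ℂ)⁻¹ ^ 2 • (σ (x q .pos) * u₁ - (q : ℂ) ^ 2 • (u₂ * x q .neg) + σ (x q .zero) * v₁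
    + v₁ * x q .zero + (q : ℂ) • v₁)

section Normalization
variable (σ : Podles q ≃ₐ[ℂ] Podles q) (a : Podles q)

/-- The image under `σ` of a defining relation, stated with an element to its right. These rules put
the `σ`-images on the left into normal order, while the relations themselves do so on the right. The
identities below then become comparisons of scalars. -/
theorem map_x_pos_zero_left : σ (x q .pos) * (σ (x q .zero) * a) =
    (q : ℂ)⁻¹ ^ 2 • (σ (x q .zero) * (σ (x q .pos) * a)) := by
  rw [← mul_assoc, ← map_mul, x_pos_zero, map_smul, map_mul, smul_mul_assoc, mul_assoc]

theorem map_x_neg_zero_left : σ (x q .neg) * (σ (x q .zero) * a) =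
    (q : ℂ) ^ 2 • (σ (x q .zero) * (σ (x q .neg) * a)) := by
  rw [← mul_assoc, ← map_mul, x_neg_zero, map_smul, map_mul, smul_mul_assoc, mul_assoc]

theorem map_x_pos_neg_left : σ (x q .pos) * (σ (x q .neg) * a) =
    (q : ℂ)⁻¹ ^ 2 • (σ (x q .zero) * (σ (x q .zero) * a)) + (q : ℂ)⁻¹ • (σ (x q .zero) * a) := by
  rw [← mul_assoc, ← map_mul, x_pos_neg, pow_two (x q .zero), map_add, map_smul, map_smul,
    map_mul, add_mul, smul_mul_assoc, smul_mul_assoc, mul_assoc]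

theorem map_x_neg_pos_left : σ (x q .neg) * (σ (x q .pos) * a) =
    (q : ℂ) ^ 2 • (σ (x q .zero) * (σ (x q .zero) * a)) + (q : ℂ) • (σ (x q .zero) * a) := by
  rw [← mul_assoc, ← map_mul, x_neg_pos, pow_two (x q .zero), map_add, map_smul, map_smul,
    map_mul, add_mul, smul_mul_assoc, smul_mul_assoc, mul_assoc]

end Normalization

section Contraction
variable (σ : Podles q ≃ₐ[ℂ] Podles q) (u₁ u₂ v₁ v₂ : Podles q)

/-- This and the next two identities hold for arbitrary coefficients. Their right-hand sides are
built from the cycle equations, so for a cycle they say how `dualPairing` commutes with the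
generators. -/
theorem dualPairing_mul_zero : dualPairing σ u₁ u₂ v₁ * x q .zero
    - σ (x q .zero) * dualPairing σ u₁ u₂ v₁ =
    relNeg σ u₂ v₁ v₂ * x q .neg - σ (x q .pos) * relPos σ u₁ v₁ v₂ := by
  have hq : (q : ℂ) ≠ 0 := q.ne_zero
  simp only [dualPairing, relNeg, relPos, relZero, mul_add, add_mul, mul_sub, sub_mul,
    mul_smul_comm, smul_mul_assoc, mul_assoc, x_pos_zero, x_neg_zero, x_pos_neg, x_neg_pos,
    map_x_pos_zero_left, map_x_neg_zero_left, map_x_pos_neg_left, map_x_neg_pos_left,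
    pow_two (x q .zero), smul_add, smul_sub, smul_smul, neg_mul, mul_neg, zero_add, add_zero]
  match_scalars <;> field_simp <;> ring

theorem dualPairing_mul_pos : (q : ℂ) ^ 2 • (dualPairing σ u₁ u₂ v₁ * x q .pos)
    - σ (x q .pos) * dualPairing σ u₁ u₂ v₁ =
    σ (x q .pos) * relZero σ u₁ u₂ v₁ v₂ + (q : ℂ) • relNeg σ u₂ v₁ v₂
      + (q : ℂ) ^ 2 • (relNeg σ u₂ v₁ v₂ * x q .zero) + σ (x q .zero) * relNeg σ u₂ v₁ v₂ := by
  have hq : (q : ℂ) ≠ 0 := q.ne_zero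
  simp only [dualPairing, relNeg, relPos, relZero, mul_add, add_mul, mul_sub, sub_mul,
    mul_smul_comm, smul_mul_assoc, mul_assoc, x_pos_zero, x_neg_zero, x_pos_neg, x_neg_pos,
    map_x_pos_zero_left, map_x_neg_zero_left, map_x_pos_neg_left, map_x_neg_pos_left,
    pow_two (x q .zero), smul_add, smul_sub, smul_smul, neg_mul, mul_neg, zero_add, add_zero]
  match_scalars <;> field_simp <;> ring

theorem dualPairing_mul_neg : (q : ℂ)⁻¹ ^ 2 • (dualPairing σ u₁ u₂ v₁ * x q .neg)
    - σ (x q .neg) * dualPairing σ u₁ u₂ v₁ =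
    -((q : ℂ)⁻¹ ^ 2 • (relZero σ u₁ u₂ v₁ v₂ * x q .neg) + σ (x q .zero) * relPos σ u₁ v₁ v₂
      + (q : ℂ)⁻¹ • relPos σ u₁ v₁ v₂ + (q : ℂ)⁻¹ ^ 2 • (relPos σ u₁ v₁ v₂ * x q .zero)) := by
  have hq : (q : ℂ) ≠ 0 := q.ne_zero
  simp only [dualPairing, relNeg, relPos, relZero, mul_add, add_mul, mul_sub, sub_mul,
    mul_smul_comm, smul_mul_assoc, mul_assoc, x_pos_zero, x_neg_zero, x_pos_neg, x_neg_pos,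
    map_x_pos_zero_left, map_x_neg_zero_left, map_x_pos_neg_left, map_x_neg_pos_left,
    pow_two (x q .zero), smul_add, smul_sub, smul_smul, neg_mul, mul_neg, zero_add, add_zero]
  match_scalars <;> field_simp <;> ring

variable {σ u₁ u₂ v₁ v₂} in
/-- The chain `relChain (u₁, u₂, v₁, v₂)` of a cycle is homologous to a multiple of the fundamental
cycle. -/
theorem relChain_sub_mem_boundaries (h₁ : relPos σ u₁ v₁ v₂ = 0) (h₂ : relNeg σ u₂ v₁ v₂ = 0)
    (h₃ : relZero σ u₁ u₂ v₁ v₂ = 0) :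
    relChain q (u₁, u₂, v₁, v₂) - relChain q
      (-(2 : ℂ) • (dualPairing σ u₁ u₂ v₁ * x q .neg),
        (2 : ℂ) • (dualPairing σ u₁ u₂ v₁ * x q .pos),
        (2 : ℂ) • (dualPairing σ u₁ u₂ v₁ * x q .zero) + (q : ℂ) • dualPairing σ u₁ u₂ v₁,
        -((2 : ℂ) • (dualPairing σ u₁ u₂ v₁ * x q .zero) + (q : ℂ)⁻¹ • dualPairing σ u₁ u₂ v₁))
      ∈ boundaries σ 2 := by
  have hq : (q : ℂ) ≠ 0 := q.ne_zero
  -- The multipliers of the four syzygies are chosen so that each component of their sum agrees with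
  -- the required difference up to multiples of the cycle equations. These multiples are the `e`
  -- below.
  have H := (boundaries σ 2).add_mem ((boundaries σ 2).add_mem ((boundaries σ 2).add_mem
    (relChain_syzygy_pos_neg_pos σ ((q : ℂ)⁻¹ • u₁ + (2 * (q : ℂ)⁻¹ ^ 2) • (u₁ * x q .zero)
      - (4 : ℂ) • (v₂ * x q .neg)))
    (relChain_syzygy_neg_pos_neg σ ((q : ℂ) • u₂ + (2 : ℂ) • (σ (x q .zero) * u₂))))
    (relChain_syzygy_pos_neg_zero σ (-(q : ℂ)⁻¹ • v₁
      - (2 * (q : ℂ)⁻¹ ^ 2) • (σ (x q .zero) * v₁) - (2 * (q : ℂ)⁻¹ ^ 2) • (σ (x q .pos) * u₁))))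
    (relChain_syzygy_neg_pos_zero σ ((q : ℂ) • v₂ + (2 * (q : ℂ) ^ 2) • (v₂ * x q .zero)
      - (2 * (q : ℂ) ^ 2) • (σ (x q .neg) * u₂)))
  rw [← map_add, ← map_add, ← map_add] at H
  rw [← map_sub]
  convert H using 2
  ext
  · have e : (q : ℂ) • relPos σ u₁ v₁ v₂
      + (2 * (q : ℂ) ^ 2) • (σ (x q .zero) * relPos σ u₁ v₁ v₂)
      - (2 : ℂ) • (relZero σ u₁ u₂ v₁ v₂ * x q .neg) = 0 := by simp [h₁, h₃]
    linear_combination (norm := skip) e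
    simp only [Prod.fst_add, Prod.fst_sub]
    simp only [dualPairing, relNeg, relPos, relZero, mul_add, add_mul, mul_sub, sub_mul,
    mul_smul_comm, smul_mul_assoc, mul_assoc, x_pos_zero, x_neg_zero, x_pos_neg, x_neg_pos,
    map_x_pos_zero_left, map_x_neg_zero_left, map_x_pos_neg_left, map_x_neg_pos_left,
    pow_two (x q .zero), smul_add, smul_sub, smul_smul, neg_mul, mul_neg, zero_add, add_zero]
    match_scalars <;> field_simp <;> ring
  · have e : -(q : ℂ)⁻¹ • relNeg σ u₂ v₁ v₂
      - (2 : ℂ) • (relNeg σ u₂ v₁ v₂ * x q .zero) = 0 := by simp [h₂]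
    linear_combination (norm := skip) e
    simp only [Prod.fst_add, Prod.fst_sub, Prod.snd_add, Prod.snd_sub]
    simp only [dualPairing, relNeg, relPos, relZero, mul_add, add_mul, mul_sub, sub_mul,
    mul_smul_comm, smul_mul_assoc, mul_assoc, x_pos_zero, x_neg_zero, x_pos_neg, x_neg_pos,
    map_x_pos_zero_left, map_x_neg_zero_left, map_x_pos_neg_left, map_x_neg_pos_left,
    pow_two (x q .zero), smul_add, smul_sub, smul_smul, neg_mul, mul_neg, zero_add, add_zero]
    match_scalars <;> field_simp <;> ring
  · have e : (2 : ℂ) • (σ (x q .pos) * relPos σ u₁ v₁ v₂)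
      + (2 : ℂ) • (relNeg σ u₂ v₁ v₂ * x q .neg) = 0 := by simp [h₁, h₂]
    linear_combination (norm := skip) -e
    simp only [Prod.fst_add, Prod.fst_sub, Prod.snd_add, Prod.snd_sub]
    simp only [dualPairing, relNeg, relPos, relZero, mul_add, add_mul, mul_sub, sub_mul,
    mul_smul_comm, smul_mul_assoc, mul_assoc, x_pos_zero, x_neg_zero, x_pos_neg, x_neg_pos,
    map_x_pos_zero_left, map_x_neg_zero_left, map_x_pos_neg_left, map_x_neg_pos_left,
    pow_two (x q .zero), smul_add, smul_sub, smul_smul, neg_mul, mul_neg, zero_add, add_zero]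
    match_scalars <;> field_simp <;> ring
  · have e : -(q : ℂ)⁻¹ • relZero σ u₁ u₂ v₁ v₂
      - (2 : ℂ) • (relZero σ u₁ u₂ v₁ v₂ * x q .zero) = 0 := by simp [h₃]
    linear_combination (norm := skip) e
    simp only [Prod.snd_add, Prod.snd_sub]
    simp only [dualPairing, relNeg, relPos, relZero, mul_add, add_mul, mul_sub, sub_mul,
    mul_smul_comm, smul_mul_assoc, mul_assoc, x_pos_zero, x_neg_zero, x_pos_neg, x_neg_pos,
    map_x_pos_zero_left, map_x_neg_zero_left, map_x_pos_neg_left, map_x_neg_pos_left,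
    pow_two (x q .zero), smul_add, smul_sub, smul_smul, neg_mul, mul_neg, zero_add, add_zero]
    match_scalars <;> field_simp <;> ring

end Contraction

theorem mem_HZero_of_x {τ : Podles q ≃ₐ[ℂ] Podles q} {c : Podles q}
    (h : ∀ i, c * x q i = τ (x q i) * c) : c ∈ HZero τ := by
  rw [mem_HZero]
  intro b
  obtain ⟨b, rfl⟩ := mk_surjective b
  induction b using FreeAlgebra.induction with
  | grade0 r => simp only [AlgHom.commutes, AlgEquiv.commutes]; exact (Algebra.commutes r _).symm
  | grade1 i => exact h i
  | mul a b ha hb => simp only [map_mul]; rw [← mul_assoc, ha, mul_assoc, hb, mul_assoc]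
  | add a b ha hb => simp only [map_add, mul_add, add_mul, ha, hb]

theorem sigmaMod_inv_x (i : Gen) :
    (sigmaMod q)⁻¹ (x q i) = (weight (q ^ 2) i)⁻¹ • x q i := by
  have hq : (q : ℂ) ≠ 0 := q.ne_zero
  change (sigmaMod q).symm (x q i) = _
  rw [AlgEquiv.symm_apply_eq, map_smul, sigmaMod, scale_x, smul_smul, inv_mul_cancel₀, one_smul]
  cases i <;> simp [weight, hq]

theorem dualPairing_mem_HZero {σ : Podles q ≃ₐ[ℂ] Podles q} {u₁ u₂ v₁ v₂ : Podles q}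
    (h₁ : relPos σ u₁ v₁ v₂ = 0) (h₂ : relNeg σ u₂ v₁ v₂ = 0)
    (h₃ : relZero σ u₁ u₂ v₁ v₂ = 0) :
    dualPairing σ u₁ u₂ v₁ ∈ HZero (σ * (sigmaMod q)⁻¹) := by
  have hq : (q : ℂ) ≠ 0 := q.ne_zero
  have ez := dualPairing_mul_zero σ u₁ u₂ v₁ v₂
  have ep := dualPairing_mul_pos σ u₁ u₂ v₁ v₂
  have en := dualPairing_mul_neg σ u₁ u₂ v₁ v₂
  simp only [h₁, h₂, h₃, zero_mul, mul_zero, smul_zero, add_zero, neg_zero, sub_zero,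
    sub_eq_zero] at ez ep en
  refine mem_HZero_of_x fun i => ?_
  rw [AlgEquiv.mul_apply, sigmaMod_inv_x, map_smul, smul_mul_assoc]
  cases i with
  | neg => rw [← en, smul_smul]; simp [weight, hq]
  | zero => rw [← ez]; simp [weight]
  | pos => rw [← ep, smul_smul]; simp [weight, hq]

/-- Centrality turns `τ(a)c` into `ca`, so capping is left multiplication by `c` on the zeroth
factor. The cycle `dA` is the relation chain with coefficients `-2x₋₁`, `2x₁`, `2x₀ + q`, `-(2x₀ +
q⁻¹)`, and its `x₀ ⊗ x₀` terms come from the last two of them. -/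
theorem capChain_dChain {τ : Podles q ≃ₐ[ℂ] Podles q} {c : Podles q} (hc : c ∈ HZero τ) :
    capChain τ 2 c (dChain q) = relChain q
      (-(2 : ℂ) • (c * x q .neg), (2 : ℂ) • (c * x q .pos), (2 : ℂ) • (c * x q .zero) + (q : ℂ) • c,
        -((2 : ℂ) • (c * x q .zero) + (q : ℂ)⁻¹ • c)) := by
  have hq : (q : ℂ) ≠ 0 := q.ne_zero
  have h := mem_HZero.1 hc
  simp only [dChain, map_add, map_sub, map_smul, capChain_tensor₃, ← h, mul_one, relChain_apply]
  simp only [← tensor₃Lin_apply, map_add, map_smul, map_neg, LinearMap.add_apply,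
    LinearMap.smul_apply, LinearMap.neg_apply]
  match_scalars <;> field_simp <;> ring

/-- Every 2-cycle is homologous to a multiple of the fundamental cycle by a twisted central
element. -/
theorem exists_sub_capChain_mem_boundaries (σ : Podles q ≃ₐ[ℂ] Podles q)
    {ω : Chain ℂ (Podles q) 2} (hω : boundary σ 1 ω = 0) :
    ∃ c ∈ HZero (σ * (sigmaMod q)⁻¹),
      ω - capChain (σ * (sigmaMod q)⁻¹) 2 c (dChain q) ∈ boundaries σ 2 := by
  obtain ⟨u₁, u₂, v₁, v₂, h₁, h₂, h₃, h⟩ := exists_relChain_of_cycle σ hω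
  have hc := dualPairing_mem_HZero h₁ h₂ h₃
  refine ⟨_, hc, ?_⟩
  rw [capChain_dChain hc]
  simpa using (boundaries σ 2).add_mem h (relChain_sub_mem_boundaries h₁ h₂ h₃)

end Podles

/-! ### Determination of the twisted central elements. -/

namespace Podles
open TwistedHochschild SkewLaurent
variable {q : ℂˣ}

namespace SkewLaurent

theorem exists_finset_eq_sum_mono (a : SkewLaurent q) :
    ∃ s : Finset ℤ, (∀ n ∉ s, cf q n a = 0) ∧ a = ∑ n ∈ s, mono q n (cf q n a) := by
  have hs : ∃ s : Finset ℤ, ∀ n ∉ s, cf q n a = 0 := by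
    induction a using SkewLaurent.induction with
    | zero => exact ⟨∅, fun n _ => map_zero _⟩
    | mono n f => exact ⟨{n}, fun m hm => by rw [cf_mono, if_neg]; simpa [eq_comm] using hm⟩
    | add a b ha hb =>
      obtain ⟨s, hs⟩ := ha
      obtain ⟨t, ht⟩ := hb
      refine ⟨s ∪ t, fun n hn => ?_⟩
      rw [Finset.notMem_union] at hn
      rw [map_add, hs n hn.1, ht n hn.2, add_zero]
  obtain ⟨s, hs⟩ := hs
  refine ⟨s, hs, SkewLaurent.ext fun n => ?_⟩
  rw [map_sum]
  simp only [cf_mono]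
  rw [Finset.sum_ite_eq']
  split_ifs with h
  · rfl
  · exact hs n h

/-- Used at extreme degrees, where a single pair of homogeneous components contributes to the
product. -/
theorem cf_mul_of_unique {a b : SkewLaurent q} (k m : ℤ)
    (h : ∀ n, n ≠ m → cf q n a = 0 ∨ cf q (k - n) b = 0) :
    cf q k (a * b) = cf q m a * scaleX q m (cf q (k - m) b) := by
  obtain ⟨s, hs, ha⟩ := exists_finset_eq_sum_mono a
  conv_lhs => rw [ha, Finset.sum_mul, map_sum]
  simp only [cf_mono_mul]
  refine Finset.sum_eq_single m (fun n _ hn => ?_) fun hm => ?_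
  · rcases h n hn with h | h <;> simp [h]
  · rw [hs m hm, zero_mul]

theorem exists_top {a : SkewLaurent q} (ha : a ≠ 0) :
    ∃ n, cf q n a ≠ 0 ∧ ∀ m, n < m → cf q m a = 0 := by
  classical
  obtain ⟨s, hs, h⟩ := exists_finset_eq_sum_mono a
  have hne : (s.filter fun n => cf q n a ≠ 0).Nonempty := by
    by_contra hcon
    rw [Finset.not_nonempty_iff_eq_empty, Finset.filter_eq_empty_iff] at hcon
    refine ha (h.trans (Finset.sum_eq_zero fun n hn => ?_))
    rw [not_not.1 (hcon hn), map_zero]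
  refine ⟨_, (Finset.mem_filter.1 (Finset.max'_mem _ hne)).2, fun m hm => ?_⟩
  by_contra hcon
  have hms : m ∈ s := by_contra fun h => hcon (hs m h)
  exact absurd (Finset.le_max' _ m (Finset.mem_filter.2 ⟨hms, hcon⟩)) (not_le.2 hm)

theorem exists_bot {a : SkewLaurent q} (ha : a ≠ 0) :
    ∃ n, cf q n a ≠ 0 ∧ ∀ m, m < n → cf q m a = 0 := by
  classical
  obtain ⟨s, hs, h⟩ := exists_finset_eq_sum_mono a
  have hne : (s.filter fun n => cf q n a ≠ 0).Nonempty := by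
    by_contra hcon
    rw [Finset.not_nonempty_iff_eq_empty, Finset.filter_eq_empty_iff] at hcon
    refine ha (h.trans (Finset.sum_eq_zero fun n hn => ?_))
    rw [not_not.1 (hcon hn), map_zero]
  refine ⟨_, (Finset.mem_filter.1 (Finset.min'_mem _ hne)).2, fun m hm => ?_⟩
  by_contra hcon
  have hms : m ∈ s := by_contra fun h => hcon (hs m h)
  exact absurd (Finset.min'_le _ m (Finset.mem_filter.2 ⟨hms, hcon⟩)) (not_le.2 hm)

theorem eq_mono_of_cf_eq_zero {a : SkewLaurent q} {n : ℤ} (h : ∀ m, m ≠ n → cf q m a = 0) :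
    a = mono q n (cf q n a) := by
  refine SkewLaurent.ext fun m => ?_
  rw [cf_mono]
  split_ifs with hm
  · rw [hm]
  · exact h m (Ne.symm hm)

/-- An element `b` with `b c = c X` for some `c ≠ 0` is homogeneous of degree `0` in `y`. -/
theorem cf_eq_zero_of_mul_eq_mul_X {b c : SkewLaurent q} (hb : b ≠ 0) (hc : c ≠ 0)
    (h : b * c = c * mono q 0 Polynomial.X) {m : ℤ} (hm : m ≠ 0) : cf q m b = 0 := by
  have hmul : ∀ k, cf q k c = 0 → cf q k (b * c) = 0 := fun k hk => by
    rw [h, cf_mul_mono, sub_zero, hk, zero_mul]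
  obtain ⟨s, hs, hs'⟩ := exists_top hb
  obtain ⟨t, ht, ht'⟩ := exists_bot hb
  obtain ⟨S, hS, hS'⟩ := exists_top hc
  obtain ⟨T, hT, hT'⟩ := exists_bot hc
  -- The `y`-support of `cX` lies in that of `c`. A positive top degree of `b` would push the top
  -- degree of `bc` above it, and a negative bottom degree fails in the same way.
  have h₁ : s ≤ 0 := by
    by_contra hcon
    have := hmul (s + S) (hS' _ (by omega))
    rw [cf_mul_of_unique (s + S) s, add_sub_cancel_left] at this
    · exact mul_ne_zero hs (scaleX_ne_zero s hS) this
    · intro n hn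
      rcases lt_or_gt_of_ne hn with hn | hn
      · exact .inr (hS' _ (by omega))
      · exact .inl (hs' _ hn)
  have h₂ : 0 ≤ t := by
    by_contra hcon
    have := hmul (t + T) (hT' _ (by omega))
    rw [cf_mul_of_unique (t + T) t, add_sub_cancel_left] at this
    · exact mul_ne_zero ht (scaleX_ne_zero t hT) this
    · intro n hn
      rcases lt_or_gt_of_ne hn with hn | hn
      · exact .inl (ht' _ hn)
      · exact .inr (hT' _ (by omega))
  rcases lt_or_gt_of_ne hm with hm | hm
  · exact ht' _ (by omega)
  · exact hs' _ (by omega)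

end SkewLaurent

theorem zpow_injective_of_not_root (hq : ∀ n : ℕ, 0 < n → q ^ n ≠ 1) {m n : ℤ}
    (h : (q : ℂ) ^ m = (q : ℂ) ^ n) : m = n := by
  have hfin : ¬ IsOfFinOrder q := by
    rw [isOfFinOrder_iff_pow_eq_one]
    rintro ⟨k, hk, h⟩
    exact hq k hk h
  refine injective_zpow_iff_not_isOfFinOrder.2 hfin (Units.ext ?_)
  simpa using h

/-- A polynomial dividing its rescaling by `q⁻²` is a monomial. -/
theorem eq_monomial_of_eq_mul_scaleX (hq : ∀ n : ℕ, 0 < n → q ^ n ≠ 1) {f g : ℂ[X]} (hf : f ≠ 0)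
    (h : f = g * scaleX q 1 f) : ∃ (n : ℕ) (r : ℂ), r ≠ 0 ∧ f = Polynomial.monomial n r := by
  have hq0 : (q : ℂ) ≠ 0 := q.ne_zero
  have hg : g ≠ 0 := by rintro rfl; exact hf (by rw [h, zero_mul])
  -- Rescaling does not lower the degree, so the cofactor `g` is a constant.
  have hdeg : f.natDegree ≤ (scaleX q 1 f).natDegree := by
    refine Polynomial.le_natDegree_of_ne_zero ?_
    rw [coeff_scaleX]
    exact mul_ne_zero (zpow_ne_zero _ hq0) (Polynomial.leadingCoeff_ne_zero.2 hf)
  have hg0 : g.natDegree = 0 := by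
    have := congrArg Polynomial.natDegree h
    rw [Polynomial.natDegree_mul hg (scaleX_ne_zero 1 hf)] at this
    omega
  obtain ⟨μ, rfl⟩ := Polynomial.natDegree_eq_zero.1 hg0
  -- The constant is determined by any exponent that occurs. As `q` is not a root of unity, only one
  -- exponent can occur.
  have hcoeff : ∀ i, f.coeff i ≠ 0 → (q : ℂ) ^ (2 * (i : ℤ)) = μ := by
    intro i hi
    have := congrArg (Polynomial.coeff · i) h
    simp only [Polynomial.coeff_C_mul, coeff_scaleX] at this
    have h1 : 1 = μ * (q : ℂ) ^ (-2 * 1 * (i : ℤ)) :=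
      mul_right_cancel₀ hi (by rw [one_mul, mul_assoc]; exact this)
    rw [show (-2 * 1 * (i : ℤ)) = -(2 * i) by ring, zpow_neg] at h1
    have hne : (q : ℂ) ^ (2 * (i : ℤ)) ≠ 0 := zpow_ne_zero _ hq0
    field_simp at h1
    exact h1
  refine ⟨f.natDegree, f.leadingCoeff, Polynomial.leadingCoeff_ne_zero.2 hf, ?_⟩
  ext i
  rw [Polynomial.coeff_monomial]
  split_ifs with hi
  · rw [← hi]; rfl
  · by_contra hcon
    apply hi
    have := zpow_injective_of_not_root hq ((hcoeff i hcon).trans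
      (hcoeff f.natDegree (Polynomial.leadingCoeff_ne_zero.2 hf)).symm)
    omega

theorem xpowPoly_neg_one : xpowPoly q (-1) = negPosPoly q := by
  have h := toSkewLaurent_xpow (q := q) (-1)
  have hx : xpow q (-1) = x q .neg := by simpa using xpow_neg_natCast (q := q) 1
  rw [hx, toSkewLaurent_x, genImage] at h
  have := congrArg (cf q (-1)) h
  rw [cf_mono, cf_mono, if_pos rfl, if_pos rfl] at this
  exact this.symm

theorem eval_negPosPoly (r : ℂ) : (negPosPoly q).eval r = (q : ℂ) ^ 2 * r ^ 2 + q * r := by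
  simp [negPosPoly]

/-- The degree `-1` part of the sphere is `ℂ[x₀]x₋₁`, so its coefficients are multiples of
`negPosPoly`, which has the root `-q⁻¹`. This constraint, absent from the whole Laurent algebra,
rules out powers of `y` as twisted central elements. -/
theorem eval_cf_neg_one (a : Podles q) :
    (cf q (-1) (toSkewLaurent q a)).eval (-(q : ℂ)⁻¹) = 0 := by
  have hq : (q : ℂ) ≠ 0 := q.ne_zero
  have ha : a ∈ Submodule.span ℂ (Set.range (pbw q)) := by rw [span_pbw]; trivial
  induction ha using Submodule.span_induction with
  | zero => simp
  | add a b _ _ ha hb => rw [map_add, map_add, Polynomial.eval_add, ha, hb, add_zero]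
  | smul c a _ ha => rw [map_smul, map_smul, Polynomial.eval_smul, ha, smul_zero]
  | mem a ha =>
    obtain ⟨⟨j, i⟩, rfl⟩ := ha
    rw [toSkewLaurent_pbw, cf_mono]
    split_ifs with hj
    · change j = -1 at hj
      subst hj
      rw [xpowPoly_neg_one, Polynomial.eval_mul, eval_negPosPoly]
      field_simp
      ring
    · simp

theorem x_zero_pow_mem (n : ℕ) : x q .zero ^ n ∈ HZero (sigmaMod q ^ n) := by
  rw [mem_HZero]
  induction n with
  | zero => simp
  | succ n ih =>
    intro b
    rw [pow_succ, mul_assoc, mem_HZero.1 x_zero_mem, ← mul_assoc, ih, mul_assoc]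
    rfl

theorem eq_zero_of_mul_x_zero_pow_eq_zero {a : Podles q} {n : ℕ} (h : a * x q .zero ^ n = 0) :
    a = 0 := by
  refine (injective_iff_map_eq_zero (toSkewLaurent q)).1 toSkewLaurent_injective a
    (SkewLaurent.ext fun m => ?_)
  have := congrArg (fun z => cf q m (toSkewLaurent q z)) h
  simp only [map_mul, toSkewLaurent_zero_pow, cf_mul_mono, map_zero, sub_zero] at this
  rw [map_zero]
  exact (mul_eq_zero.1 this).resolve_right (scaleX_ne_zero m (pow_ne_zero n Polynomial.X_ne_zero))

/-- The nonzero twisted central elements are the multiples of the powers of `x₀`. -/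
theorem exists_eq_smul_x_zero_pow (hq : ∀ n : ℕ, 0 < n → q ^ n ≠ 1) {τ : Podles q ≃ₐ[ℂ] Podles q}
    {c : Podles q} (hc : c ∈ HZero τ) (hc0 : c ≠ 0) :
    ∃ (n : ℕ) (r : ℂ), c = r • x q .zero ^ n ∧ τ = sigmaMod q ^ n := by
  have hq0 : (q : ℂ) ≠ 0 := q.ne_zero
  have hcent := mem_HZero.1 hc
  set C := toSkewLaurent q c with hC
  have hC0 : C ≠ 0 := fun h => hc0 (toSkewLaurent_injective (h.trans (map_zero _).symm))
  have hmul : ∀ i, toSkewLaurent q (τ (x q i)) * C = C * genImage q i := fun i => by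
    rw [hC, ← toSkewLaurent_x, ← map_mul, ← map_mul, hcent]
  have hz0 : toSkewLaurent q (τ (x q .zero)) ≠ 0 := by
    intro h
    have h1 := toSkewLaurent_injective (h.trans (map_zero _).symm)
    have h2 : x q .zero = 0 := τ.injective (h1.trans (map_zero τ).symm)
    have h3 := congrArg (cf q 0 ∘ toSkewLaurent q) h2
    simp only [Function.comp_apply, toSkewLaurent_x, genImage, cf_mono, map_zero, if_true] at h3
    exact Polynomial.X_ne_zero h3
  have hdeg : ∀ m, m ≠ 0 → cf q m (toSkewLaurent q (τ (x q .zero))) = 0 := fun m hm =>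
    cf_eq_zero_of_mul_eq_mul_X hz0 hC0 (hmul .zero) hm
  set g := cf q 0 (toSkewLaurent q (τ (x q .zero))) with hg
  have hz : toSkewLaurent q (τ (x q .zero)) = mono q 0 g := eq_mono_of_cf_eq_zero hdeg
  -- As `τ(x₀)` is a polynomial `g(X)`, each degree in the support of `C` prescribes `g`. Different
  -- degrees prescribe different multiples of `X`, so `C` is homogeneous.
  have hgX : ∀ n, cf q n C ≠ 0 → g = Polynomial.C ((q : ℂ) ^ (-2 * n)) * Polynomial.X := by
    intro n hn
    have h := congrArg (cf q n) (hmul .zero)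
    rw [hz, genImage, cf_mono_mul, cf_mul_mono, scaleX_zero, sub_zero, scaleX_X, mul_comm] at h
    exact mul_left_cancel₀ hn h
  obtain ⟨d, hd, -⟩ := exists_top hC0
  have hCd : C = mono q d (cf q d C) := by
    refine eq_mono_of_cf_eq_zero fun m hm => ?_
    by_contra hcon
    have h := congrArg (Polynomial.coeff · 1) ((hgX m hcon).symm.trans (hgX d hd))
    simp only [Polynomial.coeff_C_mul, Polynomial.coeff_X_one, mul_one] at h
    have := zpow_injective_of_not_root hq h
    omega
  set f := cf q d C with hf
  -- Commutation with `x₁` makes `f` divisible by its own rescaling, hence a monomial.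
  have hpos : f = cf q 1 (toSkewLaurent q (τ (x q .pos))) * scaleX q 1 f := by
    have h := congrArg (cf q (d + 1)) (hmul .pos)
    rw [hCd, genImage, mono_mul_mono, cf_mono, if_pos rfl, map_one, mul_one, cf_mul_mono] at h
    simpa using h.symm
  obtain ⟨n, r, hr, hfn⟩ := eq_monomial_of_eq_mul_scaleX hq hd hpos
  have hneg : cf q (-1) (toSkewLaurent q (τ (x q .neg))) * scaleX q (-1) f =
      f * scaleX q d (negPosPoly q) := by
    have h := congrArg (cf q (d + -1)) (hmul .neg)
    rw [hCd, genImage, mono_mul_mono, cf_mono, if_pos rfl, cf_mul_mono] at h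
    simpa using h
  -- Commutation with `x₋₁` is evaluated at `-q⁻¹`. The left side vanishes and the monomial `f` does
  -- not, so `q^{-2d}(-q⁻¹)` is a root of `negPosPoly`. This says `q^{-2d} = 1`.
  have hd0 : d = 0 := by
    have h := congrArg (Polynomial.eval (-(q : ℂ)⁻¹)) hneg
    rw [Polynomial.eval_mul, eval_cf_neg_one, zero_mul, Polynomial.eval_mul, hfn,
      Polynomial.eval_monomial, eval_scaleX, eval_negPosPoly] at h
    have h1 := (mul_eq_zero.1 h.symm).resolve_left
      (mul_ne_zero hr (pow_ne_zero _ (neg_ne_zero.2 (inv_ne_zero hq0))))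
    have hne : (q : ℂ) ^ (-2 * d) ≠ 0 := zpow_ne_zero _ hq0
    have h2 : (q : ℂ) ^ (-2 * d) * ((q : ℂ) ^ (-2 * d) - 1) = 0 := by
      rw [← h1]
      field_simp
      ring
    have h3 := sub_eq_zero.1 ((mul_eq_zero.1 h2).resolve_left hne)
    have := zpow_injective_of_not_root hq (h3.trans (zpow_zero _).symm)
    omega
  have hc' : c = r • x q .zero ^ n := by
    apply toSkewLaurent_injective
    rw [map_smul, toSkewLaurent_zero_pow, ← map_smul, ← hC, hCd, hd0, hfn,
      Polynomial.smul_X_eq_monomial]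
  -- Right multiplication by `x₀ⁿ` is injective, so a nonzero multiple of `x₀ⁿ` determines its
  -- automorphism.
  refine ⟨n, r, hc', AlgEquiv.ext fun b => ?_⟩
  have hb := hcent b
  rw [hc', smul_mul_assoc, mul_smul_comm, mem_HZero.1 (x_zero_pow_mem n)] at hb
  rw [← sub_eq_zero]
  refine eq_zero_of_mul_x_zero_pow_eq_zero (n := n) ?_
  rw [sub_mul, sub_eq_zero]
  exact (smul_right_injective _ hr hb).symm

end Podles

/-! ### Twisted traces, derivations and the cocycles detecting `dA`. -/

namespace Podles
open TwistedHochschild SkewLaurent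
variable {q : ℂˣ}

namespace SkewLaurent

variable (q) in
/-- The linear endomorphism `∑ fₙ yⁿ ↦ ∑ Lₙ(fₙ) yⁿ`. -/
def coeffwise (L : ℤ → ℂ[X] →ₗ[ℂ] ℂ[X]) : SkewLaurent q →ₗ[ℂ] SkewLaurent q :=
  (Finsupp.lsum ℂ fun n : Multiplicative ℤ =>
    (mono q n.toAdd ∘ₗ L n.toAdd : ScaledPolynomial q →ₗ[ℂ] SkewLaurent q)) ∘ₗ
  (SkewMonoidAlgebra.coeffLinearEquiv (S := ℂ) : SkewLaurent q ≃ₗ[ℂ] _).toLinearMap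

theorem coeffwise_mono (L : ℤ → ℂ[X] →ₗ[ℂ] ℂ[X]) (n : ℤ) (f : ℂ[X]) :
    coeffwise q L (mono q n f) = mono q n (L n f) := by
  rw [coeffwise, LinearMap.comp_apply]
  exact Finsupp.lsum_single ℂ _ _ _

theorem bilinear_ext {N : Type*} [AddCommGroup N] [Module ℂ N]
    {B B' : SkewLaurent q →ₗ[ℂ] SkewLaurent q →ₗ[ℂ] N}
    (h : ∀ m f n g, B (mono q m f) (mono q n g) = B' (mono q m f) (mono q n g)) : B = B' := by
  refine LinearMap.ext₂ fun a b => ?_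
  induction a using SkewLaurent.induction with
  | zero => simp
  | add a a' ha ha' => simp only [map_add, LinearMap.add_apply, ha, ha']
  | mono m f =>
    induction b using SkewLaurent.induction with
    | zero => simp
    | add b b' hb hb' => simp only [map_add, hb, hb']
    | mono n g => exact h m f n g

/-- The Euler operator `X d/dX` on polynomials. -/
def euler : ℂ[X] →ₗ[ℂ] ℂ[X] := LinearMap.mulLeft ℂ Polynomial.X ∘ₗ Polynomial.derivative

theorem euler_apply (f : ℂ[X]) : euler f = Polynomial.X * Polynomial.derivative f := rfl

theorem coeff_euler (f : ℂ[X]) (i : ℕ) : (euler f).coeff i = i * f.coeff i := by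
  rw [euler_apply]
  cases i with
  | zero => simp
  | succ i => rw [Polynomial.coeff_X_mul, Polynomial.coeff_derivative]; push_cast; ring

/-- The Euler operator multiplies the coefficient of `Xⁱ` by `i` and rescaling multiplies it by a
power of `q`. Commutation is what makes the coefficientwise Euler operator a derivation of the skew
algebra. -/
theorem euler_scaleX (n : ℤ) (f : ℂ[X]) : euler (scaleX q n f) = scaleX q n (euler f) := by
  ext i
  rw [coeff_euler, coeff_scaleX, coeff_scaleX, coeff_euler]
  ring

variable (q) in
/-- The derivation `X ∂/∂X`. -/
def derivX : SkewLaurent q →ₗ[ℂ] SkewLaurent q := coeffwise q fun _ => euler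

variable (q) in
/-- The derivation `y ∂/∂y`. -/
def derivY : SkewLaurent q →ₗ[ℂ] SkewLaurent q :=
  coeffwise q fun n => (n : ℂ) • (LinearMap.id : ℂ[X] →ₗ[ℂ] ℂ[X])

theorem derivX_mul (a b : SkewLaurent q) : derivX q (a * b) = derivX q a * b + a * derivX q b := by
  have : (LinearMap.mul ℂ (SkewLaurent q)).compr₂ (derivX q) =
      (LinearMap.mul ℂ (SkewLaurent q)) ∘ₗ derivX q +
        (LinearMap.mul ℂ (SkewLaurent q)).compl₂ (derivX q) := by
    refine bilinear_ext fun m f n g => ?_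
    simp only [LinearMap.compr₂_apply, LinearMap.mul_apply', LinearMap.add_apply,
      LinearMap.comp_apply, LinearMap.compl₂_apply, derivX, mono_mul_mono, coeffwise_mono]
    rw [← map_add]
    congr 1
    rw [← euler_scaleX, euler_apply, euler_apply, euler_apply, Polynomial.derivative_mul]
    ring
  exact LinearMap.congr_fun₂ this a b

theorem derivY_mul (a b : SkewLaurent q) : derivY q (a * b) = derivY q a * b + a * derivY q b := by
  have : (LinearMap.mul ℂ (SkewLaurent q)).compr₂ (derivY q) =
      (LinearMap.mul ℂ (SkewLaurent q)) ∘ₗ derivY q +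
        (LinearMap.mul ℂ (SkewLaurent q)).compl₂ (derivY q) := by
    refine bilinear_ext fun m f n g => ?_
    simp only [LinearMap.compr₂_apply, LinearMap.mul_apply', LinearMap.add_apply,
      LinearMap.comp_apply, LinearMap.compl₂_apply, derivY, mono_mul_mono, coeffwise_mono]
    rw [← map_add]
    congr 1
    simp only [LinearMap.smul_apply, LinearMap.id_apply, map_smul, smul_mul_assoc, mul_smul_comm]
    push_cast
    module
  exact LinearMap.congr_fun₂ this a b

variable (q) in
/-- The coefficient of `Xⁿ y⁰`. -/
def trace (n : ℕ) : SkewLaurent q →ₗ[ℂ] ℂ := Polynomial.lcoeff ℂ n ∘ₗ cf q 0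

theorem trace_apply (n : ℕ) (a : SkewLaurent q) : trace q n a = (cf q 0 a).coeff n := rfl

/-- Conjugation by `Xⁿ` multiplies the `y⁻ᵏ` component by a power of `q`. Moving `yᵏ` across a
coefficient multiplies its `Xⁿ` term by the inverse power, so the two cancel precisely for the
coefficient of `Xⁿ`. -/
theorem trace_mul (n : ℕ) {b b' : SkewLaurent q}
    (h : b' * mono q 0 (Polynomial.X ^ n) = mono q 0 (Polynomial.X ^ n) * b) (a : SkewLaurent q) :
    trace q n (a * b) = trace q n (b' * a) := by
  have hq : (q : ℂ) ≠ 0 := q.ne_zero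
  have hb : ∀ k : ℤ, cf q (-k) b = (q : ℂ) ^ (2 * k * (n : ℤ)) • cf q (-k) b' := by
    intro k
    have h1 := congrArg (cf q (-k)) h
    rw [cf_mul_mono, cf_mono_mul, sub_zero, scaleX_zero, map_pow, scaleX_X, mul_pow,
      ← Polynomial.C_pow, mul_left_comm, mul_comm (cf q (-k) b'), mul_left_comm] at h1
    rw [← mul_left_cancel₀ (pow_ne_zero n Polynomial.X_ne_zero) h1, Polynomial.smul_eq_C_mul,
      zpow_mul _ _ (n : ℤ), zpow_natCast]
    congr 4
    ring
  induction a using SkewLaurent.induction with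
  | zero => simp
  | add a a' ha ha' => simp only [add_mul, mul_add, map_add, ha, ha']
  | mono k f =>
    have hθ : scaleX q k (cf q (-k) b' * scaleX q (-k) f) = scaleX q k (cf q (-k) b') * f := by
      rw [map_mul, ← scaleX_add, add_neg_cancel, scaleX_zero]
    have h2 := congrArg (Polynomial.coeff · n) hθ
    simp only [coeff_scaleX] at h2
    rw [trace_apply, trace_apply, cf_mono_mul, cf_mul_mono, zero_sub, hb, map_smul,
      mul_smul_comm, Polynomial.coeff_smul, mul_comm f, ← h2, smul_eq_mul, ← mul_assoc,
      ← zpow_add₀ hq, show 2 * k * (n : ℤ) + -2 * k * n = 0 by ring, zpow_zero, one_mul]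

end SkewLaurent

variable (q) in
/-- The twisted cocycle `a₀ ⊗ a₁ ⊗ a₂ ↦ trace (a₀ (X ∂/∂X a₁) (y ∂/∂y a₂))`. -/
def cocycle (n : ℕ) : Chain ℂ (Podles q) 2 →ₗ[ℂ] ℂ :=
  PiTensorProduct.lift ((trace q n).compMultilinearMap
    ((MultilinearMap.mkPiAlgebraFin ℂ 3 (SkewLaurent q)).compLinearMap
      ![(toSkewLaurent q).toLinearMap, derivX q ∘ₗ (toSkewLaurent q).toLinearMap,
        derivY q ∘ₗ (toSkewLaurent q).toLinearMap]))

theorem cocycle_tensor₃ (n : ℕ) (a b c : Podles q) : cocycle q n (tensor₃ ℂ a b c) =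
    trace q n (toSkewLaurent q a *
      (derivX q (toSkewLaurent q b) * derivY q (toSkewLaurent q c))) := by
  simp [cocycle, tensor₃, PiTensorProduct.lift.tprod, MultilinearMap.mkPiAlgebraFin_apply]

/-- By the Leibniz rule all faces cancel except `trace(a₀ ∂a₁ ∂'a₂ a₃)` and the cyclic one. These
agree by the twisted trace property, because `x₀ⁿ` implements `σ_modⁿ`. -/
theorem cocycle_boundary (n : ℕ) (z : Chain ℂ (Podles q) 3) :
    cocycle q n (boundary (sigmaMod q ^ n) 2 z) = 0 := by
  have h : cocycle q n ∘ₗ boundary (sigmaMod q ^ n) 2 = 0 := by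
    ext a
    have ha : a = ![a 0, a 1, a 2, a 3] := by funext i; fin_cases i <;> rfl
    have ht : toSkewLaurent q ((sigmaMod q ^ n) (a 3)) * mono q 0 (Polynomial.X ^ n) =
        mono q 0 (Polynomial.X ^ n) * toSkewLaurent q (a 3) := by
      rw [← toSkewLaurent_zero_pow, ← map_mul, ← map_mul, mem_HZero.1 (x_zero_pow_mem n)]
    have htr := trace_mul n ht (toSkewLaurent q (a 0) *
      (derivX q (toSkewLaurent q (a 1)) * derivY q (toSkewLaurent q (a 2))))
    simp only [LinearMap.compMultilinearMap_apply, LinearMap.comp_apply,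
      LinearMap.zero_compMultilinearMap, zero_apply]
    rw [ha, boundary_tensor₄]
    simp only [map_add, map_sub, cocycle_tensor₃, map_mul, derivX_mul, derivY_mul, mul_add,
      add_mul, mul_assoc] at htr ⊢
    rw [htr]
    ring
  exact LinearMap.congr_fun h z

/-- Capping by `x₀ⁿ` multiplies the zeroth factor on the left by `Xⁿ`, which shifts the coefficient
that is read off. -/
theorem cocycle_capChain (n m : ℕ) (z : Chain ℂ (Podles q) 2) :
    cocycle q (n + m) (capChain (sigmaMod q ^ n) 2 (x q .zero ^ n) z) = cocycle q m z := by
  have h : cocycle q (n + m) ∘ₗ capChain (sigmaMod q ^ n) 2 (x q .zero ^ n) = cocycle q m := by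
    ext a
    have ha : a = ![a 0, a 1, a 2] := by funext i; fin_cases i <;> rfl
    rw [LinearMap.compMultilinearMap_apply, LinearMap.compMultilinearMap_apply,
      LinearMap.comp_apply, ha]
    change cocycle q (n + m) (capChain _ 2 _ (tensor₃ ℂ _ _ _)) = cocycle q m (tensor₃ ℂ _ _ _)
    rw [capChain_tensor₃, ← mem_HZero.1 (x_zero_pow_mem n), cocycle_tensor₃, cocycle_tensor₃,
      map_mul (toSkewLaurent q), toSkewLaurent_zero_pow, mul_assoc, trace_apply,
      cf_mono_mul, scaleX_zero, sub_zero,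
      add_comm n m, Polynomial.coeff_X_pow_mul, trace_apply]
  exact LinearMap.congr_fun h z

theorem coeff_one_eq_eval_derivative (f : ℂ[X]) :
    f.coeff 1 = (Polynomial.derivative f).eval 0 := by
  rw [← Polynomial.coeff_zero_eq_eval_zero, Polynomial.coeff_derivative]
  simp

/-- Only `-q⁻¹ · 1 ⊗ x₋₁ ⊗ x₁` contributes, through the linear coefficient `q` of `negPosPoly`. The
other terms are killed by a derivation or have no `X¹` term. -/
theorem cocycle_dChain : cocycle q 1 (dChain q) = -1 := by
  have hq : (q : ℂ) ≠ 0 := q.ne_zero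
  have h1 : toSkewLaurent q 1 = mono q 0 1 := map_one _
  have hP : (negPosPoly q).eval 0 = 0 := by simp [eval_negPosPoly]
  have hP' : (Polynomial.derivative (negPosPoly q)).coeff 0 = q := by
    rw [Polynomial.coeff_derivative]
    simp only [negPosPoly, zero_add, Polynomial.coeff_add, Polynomial.coeff_C_mul,
      Polynomial.coeff_X_pow,
      Polynomial.coeff_X_one]
    simp
  simp only [dChain, map_add, map_sub, map_smul, cocycle_tensor₃]
  simp only [toSkewLaurent_x, h1, genImage, derivX, derivY, coeffwise_mono, mono_mul_mono,
    trace_apply, euler_apply, cf_mono, LinearMap.smul_apply, LinearMap.id_apply]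
  simp [coeff_one_eq_eval_derivative, scaleX_X, scaleX_zero, Polynomial.derivative_mul, hP, hP',
    eval_scaleX]

end Podles

/-! ### Functionals on the direct sum of twisted homologies. -/

namespace TwistedHochschild
section General
variable {k A : Type*} [CommRing k] [Ring A] [Algebra k A]

/-- Indices such as `σσ_mod⁻¹σ_mod` and `σ` agree only propositionally. This compares classes across
such an equality through representing chains, which do not depend on the automorphism. -/
theorem TwistedHomology.of_eq_of {n : ℕ} {σ τ : A ≃ₐ[k] A} (h : σ = τ) {z : cycles σ n}
    {w : cycles τ n} (hzw : (z : Chain k A n) - w ∈ boundaries σ n) :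
    TwistedHomology.of σ n (homologyClass σ n z) =
      TwistedHomology.of τ n (homologyClass τ n w) := by
  subst h
  congr 1
  exact (Submodule.Quotient.eq _).2 hzw

theorem TwistedCentre.of_eq_of {σ τ : A ≃ₐ[k] A} (h : σ = τ) {a : HZero σ} {b : HZero τ}
    (hab : (a : A) = b) : TwistedCentre.of σ a = TwistedCentre.of τ b := by
  subst h
  rw [Subtype.ext hab]

/-- The functional on `H_n(A, τA)` given by a functional on `C_n` which vanishes on boundaries. -/
def homologyDescend (n : ℕ) (τ : A ≃ₐ[k] A) (φ : Chain k A n →ₗ[k] k)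
    (hφ : ∀ z, φ (boundary τ n z) = 0) : Homology τ n →ₗ[k] k :=
  ((boundaries τ n).submoduleOf (cycles τ n)).liftQ (φ ∘ₗ (cycles τ n).subtype) (by
    rintro ⟨z, _⟩ ⟨w, hw⟩
    change φ z = 0
    rw [← show boundary τ n w = z from hw, hφ])

theorem homologyDescend_homologyClass (n : ℕ) (τ : A ≃ₐ[k] A) (φ : Chain k A n →ₗ[k] k)
    (hφ : ∀ z, φ (boundary τ n z) = 0) (z : cycles τ n) :
    homologyDescend n τ φ hφ (homologyClass τ n z) = φ z := rfl

open Classical in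
/-- The functional on `⨁_τ H_n(A, τA)` given by a functional on `C_n` which vanishes on the
boundaries of the summand `τ = σ`, and by zero on the other summands. -/
def homologyFunctional (n : ℕ) (σ : A ≃ₐ[k] A) (φ : Chain k A n →ₗ[k] k)
    (hφ : ∀ z, φ (boundary σ n z) = 0) : TwistedHomology k A n →ₗ[k] k :=
  DirectSum.toModule k (A ≃ₐ[k] A) k fun τ =>
    if h : τ = σ then homologyDescend n τ φ (h ▸ hφ) else 0

open Classical in
theorem homologyFunctional_of (n : ℕ) (σ : A ≃ₐ[k] A) (φ : Chain k A n →ₗ[k] k)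
    (hφ : ∀ z, φ (boundary σ n z) = 0) (τ : A ≃ₐ[k] A) (z : cycles τ n) :
    homologyFunctional n σ φ hφ (TwistedHomology.of τ n (homologyClass τ n z)) =
      if τ = σ then φ z else 0 := by
  refine (DirectSum.toModule_lof k (M := fun τ : A ≃ₐ[k] A => Homology τ n) τ _).trans ?_
  by_cases h : τ = σ
  · rw [dif_pos h, if_pos h, homologyDescend_homologyClass]
  · rw [dif_neg h, if_neg h, LinearMap.zero_apply]

end General
end TwistedHochschild

/-! ### The polynomial description of the twisted centre and freeness of `H₂`. -/

namespace Podles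
open TwistedHochschild
variable {q : ℂˣ}

theorem xZero_pow (n : ℕ) :
    xZero q ^ n = TwistedCentre.of (sigmaMod q ^ n) ⟨x q .zero ^ n, x_zero_pow_mem n⟩ := by
  induction n with
  | zero =>
    rw [pow_zero, TwistedCentre.one_def]
    exact TwistedCentre.of_eq_of (pow_zero _).symm (pow_zero _).symm
  | succ n ih =>
    rw [pow_succ, ih, xZero, TwistedCentre.of_mul_of]
    exact TwistedCentre.of_eq_of (pow_succ' _ n).symm
      ((coe_cup _ _).trans (pow_succ' (x q .zero) n).symm)

theorem aeval_xZero_monomial (n : ℕ) (r : ℂ) :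
    Polynomial.aeval (xZero q) (Polynomial.monomial n r) =
      TwistedCentre.of (sigmaMod q ^ n)
        (r • (⟨x q .zero ^ n, x_zero_pow_mem n⟩ : HZero (sigmaMod q ^ n))) := by
  rw [Polynomial.aeval_monomial, xZero_pow, ← Algebra.smul_def, map_smul]

theorem exists_aeval_eq_of (hq : ∀ n : ℕ, 0 < n → q ^ n ≠ 1) {τ : Podles q ≃ₐ[ℂ] Podles q}
    (c : HZero τ) : ∃ f : ℂ[X], Polynomial.aeval (xZero q) f = TwistedCentre.of τ c := by
  by_cases hc : c = 0
  · exact ⟨0, by rw [hc, map_zero, map_zero]⟩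
  · obtain ⟨n, r, h, hτ⟩ := exists_eq_smul_x_zero_pow hq c.2
      (fun h => hc (Subtype.ext h))
    exact ⟨Polynomial.monomial n r, (aeval_xZero_monomial n r).trans
      (TwistedCentre.of_eq_of hτ.symm h.symm)⟩

theorem aeval_xZero_surjective (hq : ∀ n : ℕ, 0 < n → q ^ n ≠ 1) :
    Function.Surjective (Polynomial.aeval (R := ℂ) (xZero q)) := by
  intro z
  induction z using TwistedCentre.induction with
  | zero => exact ⟨0, map_zero _⟩
  | of τ c => exact exists_aeval_eq_of hq c
  | add z w hz hw =>
    obtain ⟨f, rfl⟩ := hz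
    obtain ⟨g, rfl⟩ := hw
    exact ⟨f + g, map_add _ f g⟩

theorem sigmaMod_pow_injective (hq : ∀ n : ℕ, 0 < n → q ^ n ≠ 1) :
    Function.Injective fun n : ℕ => sigmaMod q ^ n := by
  have hpow : ∀ n : ℕ, (sigmaMod q ^ n) (x q .pos) = (q : ℂ) ^ (2 * n) • x q .pos := by
    intro n
    induction n with
    | zero => simp
    | succ n ih =>
      rw [pow_succ, AlgEquiv.mul_apply, sigmaMod, scale_x, map_smul, ← sigmaMod, ih, smul_smul]
      congr 1
      simp only [weight, Units.val_pow_eq_pow_val]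
      ring
  have hx : x q .pos ≠ 0 := by
    have := (pbwBasis q).ne_zero (1, 0)
    rwa [pbwBasis_apply, ← Nat.cast_one, pbw_pos, pow_one] at this
  intro m n hmn
  have h := congrArg (fun τ : Podles q ≃ₐ[ℂ] Podles q => τ (x q .pos)) hmn
  simp only [hpow] at h
  have h2 := smul_left_injective ℂ hx h
  have := zpow_injective_of_not_root hq (m := (2 * m : ℕ)) (n := (2 * n : ℕ))
    (by rw [zpow_natCast, zpow_natCast]; exact h2)
  omega

variable (q) in
/-- The functional on the twisted homology which detects `[dA] ⌢ x₀ⁿ`. -/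
def detect (n : ℕ) : TwistedHomology ℂ (Podles q) 2 →ₗ[ℂ] ℂ :=
  homologyFunctional 2 (sigmaMod q ^ (n + 1)) (cocycle q (n + 1)) (cocycle_boundary (n + 1))

theorem cap_fundamentalClass_of {τ : Podles q ≃ₐ[ℂ] Podles q} (c : HZero τ) :
    cap 2 (fundamentalClass q) (TwistedCentre.of τ c) =
      TwistedHomology.of (τ * sigmaMod q) 2 (homologyClass _ 2
        ⟨capChain τ 2 c (dChain q), capChain_mem_cycles _ τ 2 c.2 dChain_mem⟩) := by
  rw [fundamentalClass, cap_of_of, capHomology_mk]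

theorem cap_fundamentalClass_monomial (n : ℕ) (r : ℂ) :
    cap 2 (fundamentalClass q) (Polynomial.aeval (xZero q) (Polynomial.monomial n r)) =
      TwistedHomology.of (sigmaMod q ^ n * sigmaMod q) 2 (homologyClass _ 2
        ⟨capChain (sigmaMod q ^ n) 2 (r • x q .zero ^ n) (dChain q),
          capChain_mem_cycles _ _ 2 ((HZero (sigmaMod q ^ n)).smul_mem r (x_zero_pow_mem n))
            dChain_mem⟩) := by
  rw [aeval_xZero_monomial, cap_fundamentalClass_of]
  rfl

open Classical in
theorem detect_of (n : ℕ) (τ : Podles q ≃ₐ[ℂ] Podles q) (z : cycles τ 2) :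
    detect q n (TwistedHomology.of τ 2 (homologyClass τ 2 z)) =
      if τ = sigmaMod q ^ (n + 1) then cocycle q (n + 1) z else 0 :=
  homologyFunctional_of 2 _ _ _ τ z

/-- The class `[dA] ⌢ x₀ᵐ` lies in the summand of `σ_mod^{m+1}`, the extra factor coming from `dA`.
These summands are distinct, so only `m = n` survives, with the value `-1` of the cocycle on `dA`.
-/
theorem detect_cap (hq : ∀ n : ℕ, 0 < n → q ^ n ≠ 1) (n : ℕ) (f : ℂ[X]) :
    detect q n (cap 2 (fundamentalClass q) (Polynomial.aeval (xZero q) f)) = -f.coeff n := by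
  classical
  induction f using Polynomial.induction_on' with
  | add f g hf hg => rw [map_add, map_add, map_add, hf, hg, Polynomial.coeff_add, neg_add]
  | monomial m r =>
    rw [cap_fundamentalClass_monomial, detect_of, Polynomial.coeff_monomial]
    by_cases h : m = n
    · subst h
      rw [if_pos rfl, if_pos (pow_succ (sigmaMod q) m).symm]
      change cocycle q (m + 1) (capChain (sigmaMod q ^ m) 2 (r • x q .zero ^ m) (dChain q)) = -r
      rw [capChain_smul, LinearMap.smul_apply, map_smul, cocycle_capChain, cocycle_dChain,
        smul_eq_mul, mul_neg_one]
    · have hne : sigmaMod q ^ m * sigmaMod q ≠ sigmaMod q ^ (n + 1) := fun h' =>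
        h (Nat.succ_injective (@sigmaMod_pow_injective q hq (m + 1) (n + 1)
          ((pow_succ (sigmaMod q) m).trans h')))
      rw [if_neg h, if_neg hne, neg_zero]

theorem cap_aeval_injective (hq : ∀ n : ℕ, 0 < n → q ^ n ≠ 1) :
    Function.Injective fun f : ℂ[X] =>
      cap 2 (fundamentalClass q) (Polynomial.aeval (xZero q) f) := by
  intro f g h
  ext n
  have := congrArg (detect q n) h
  simpa only [detect_cap hq, neg_inj] using this

theorem exists_eq_cap (hq : ∀ n : ℕ, 0 < n → q ^ n ≠ 1) (σ : Podles q ≃ₐ[ℂ] Podles q)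
    (ω : Homology σ 2) : ∃ f : ℂ[X], TwistedHomology.of σ 2 ω =
      cap 2 (fundamentalClass q) (Polynomial.aeval (xZero q) f) := by
  obtain ⟨z, rfl⟩ := homologyClass_surjective σ 2 ω
  obtain ⟨c, hc, h⟩ := exists_sub_capChain_mem_boundaries σ (LinearMap.mem_ker.1 z.2)
  obtain ⟨f, hf⟩ := exists_aeval_eq_of hq ⟨c, hc⟩
  refine ⟨f, ?_⟩
  rw [hf, cap_fundamentalClass_of]
  exact TwistedHomology.of_eq_of (inv_mul_cancel_right σ (sigmaMod q)).symm h

theorem smul_fundamentalClass_bijective (hq : ∀ n : ℕ, 0 < n → q ^ n ≠ 1) :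
    Function.Bijective (LinearMap.toSpanSingleton ℂ[X] _ (fundamentalClass q)) := by
  constructor
  · intro f g h
    rw [LinearMap.toSpanSingleton_apply, LinearMap.toSpanSingleton_apply, polynomial_smul,
      polynomial_smul] at h
    exact cap_aeval_injective hq h
  · intro y
    induction y using TwistedHomology.induction with
    | zero => exact ⟨0, map_zero _⟩
    | of σ z =>
      obtain ⟨f, hf⟩ := exists_eq_cap hq σ (homologyClass σ 2 z)
      exact ⟨f, by rw [hf, LinearMap.toSpanSingleton_apply, polynomial_smul]⟩
    | add y y' hy hy' =>
      obtain ⟨f, rfl⟩ := hy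
      obtain ⟨g, rfl⟩ := hy'
      exact ⟨f + g, map_add _ f g⟩

end Podles

end

theorem mainTheorem2 (q : ℂˣ) (hq : ∀ n : ℕ, 0 < n → q ^ n ≠ 1) :
    (∀ b : Podles q,
      Podles.x q .zero * b = Podles.sigmaMod q b * Podles.x q .zero) ∧
    Algebra.adjoin ℂ {Podles.xZero q} = ⊤ ∧
    Function.Injective (Polynomial.aeval (R := ℂ) (Podles.xZero q)) ∧
    (∀ (σ : Podles q ≃ₐ[ℂ] Podles q) (ω : TwistedHochschild.Homology σ 2),
      ∃! f : Polynomial ℂ,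
        TwistedHochschild.TwistedHomology.of σ 2 ω =
          TwistedHochschild.cap 2 (Podles.fundamentalClass q)
            (Polynomial.aeval (Podles.xZero q) f)) ∧
    (∃ B : Module.Basis Unit (Polynomial ℂ)
        (TwistedHochschild.TwistedHomology ℂ (Podles q) 2),
      B () = Podles.fundamentalClass q) := by
  refine ⟨TwistedHochschild.mem_HZero.1 Podles.x_zero_mem, ?_, ?_, ?_, ?_⟩
  · rw [Algebra.adjoin_singleton_eq_range_aeval]
    exact (AlgHom.range_eq_top _).2 (Podles.aeval_xZero_surjective hq)
  -- If two polynomials agree at `x₀`, so do their caps with `[dA]`. Injectivity of evaluation is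
  -- thus inherited from the cap product.
  · intro f g h
    exact Podles.cap_aeval_injective hq
      (congrArg (TwistedHochschild.cap 2 (Podles.fundamentalClass q)) h)
  · intro σ ω
    obtain ⟨f, hf⟩ := Podles.exists_eq_cap hq σ ω
    exact ⟨f, hf, fun g hg => Podles.cap_aeval_injective hq (hg.symm.trans hf)⟩
  · refine ⟨(Module.Basis.singleton Unit (Polynomial ℂ)).map
      (LinearEquiv.ofBijective _ (Podles.smul_fundamentalClass_bijective hq)), ?_⟩
    rw [Module.Basis.map_apply, Module.Basis.singleton_apply, LinearEquiv.ofBijective_apply,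
      LinearMap.toSpanSingleton_apply, one_smul]
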